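/- Write $\mu^Q=\mu_1^{q_1}\cdots\mu_n^{q_n}$ and $|Q|=q_1+\dots+q_n$ for $\mu=(\mu_1,\dots,\mu_n)$ and $Q\in\mathbb N^n$ ($0\in\mathbb N$). **Definitions.** Let $\mathcal F=\{F_1,\dots,F_\ell\}$ be a finite family of germs of biholomorphisms of $(\mathbb C^n,0)$ with linear parts $D_1,\dots,D_\ell$ at $0$. (a) $\mathcal F$ is *formally* (resp. *holomorphically*) *completely integrable* if there are a formal (resp. holomorphic) biholomorphism $\Phi$ of $(\mathbb C^n,0)$ and formal power series (resp. germs of holomorphic functions) $\mu_{mj}$, $1\le m\le\ell$, $1\le j\le n$, such that $\hat F_m:=\Phi^{-1}\circ F_m\circ\Phi$ is the map $$\hat F_m(z)=(\mu_{m1}(z)z_1,\dots,\mu_{mn}(z)z_n),$$ such that $\mu_{mj}\circ\hat D_{m'}=\mu_{mj}$ for all $m,m',j$, where $\hat D_{m'}=\mathrm{diag}(\mu_{m'1}(0),\dots,\mu_{m'n}(0))$ is the linear part of $\hat F_{m'}$ (so $\hat D_{m'}=D_{m'}$ if $\Phi$ is tangent to the identity), and such that for all $j$ and all $Q\in\mathbb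 N^n$ with $|Q|>1$: $\mu_m(0)^Q=\mu_{mj}(0)$ for all $m$ if and only if $\mu_m(z)^Q=\mu_{mj}(z)$ identically for all $m$. (Such a family commutes pairwise.) (b) A family of diagonal matrices $\mathrm{diag}(\mu_{i1},\dots,\mu_{in})$, $1\le i\le\ell$, is *of Poincaré type* if there are constants $d>1$, $c>0$ such that for each $(j,Q)\in\{1,\dots,n\}\times\mathbb N^n$ with $\mu_m^Q\ne\mu_{mj}$ for some $m$ there is $(i,Q')\in\{1,\dots,\ell\}\times\mathbb N^n$ with $\mu_k^{Q'}=\mu_k^Q$ for all $1\le k\le\ell$, $\mu_i^{Q'}\neq\mu_{ij}$, $\max(|\mu_i^{Q'}|,|\mu_i^{-Q'}|)>c^{-1}d^{|Q'|}$ and $Q'-Q\in\mathbb N^n\cup(-\mathbb N^n)$. A family of linear maps is of Poincaré type if it is simultaneously diagonalizable and its matrices in a basis of common eigenvectors are of Poincaré type. (c) Let $D_i=\mathrm{diag}(\mu_{i1},\dots,\mu_{in})$. A formal map $\Phi$ of $(\mathbb C^n,0)$ is *normalized* with respect to $D=\{D_i\}$ if it is tangent to the identity and, for all $j$ and all $Q$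 with $|Q|\ge2$ and $\mu_i^Q=\mu_{ij}$ for all $i$, the coefficient of $z^Q$ in $\Phi_j$ is $0$. It transforms $\mathcal F$ into a *normal form* if every $\Phi^{-1}\circ F_i\circ\Phi$ commutes with every $D_m$. **Theorem.** Let $\mathcal F=\{F_1,\dots,F_\ell\}$ be a finite family of germs of biholomorphisms of $(\mathbb C^n,0)$ which is formally completely integrable and whose family of linear parts is of Poincaré type. Then $\mathcal F$ is holomorphically completely integrable. Moreover, if the linear parts are diagonal, $D_i=\mathrm{diag}(\mu_{i1},\dots,\mu_{in})$, then there is a unique formal map $\Phi$ that is normalized with respect to $D$ and transforms $\mathcal F$ into a normal form; this $\Phi$ converges, and $\Phi^{-1}\circ F_i\circ\Phi$ is the map $x_j'=\mu_{ij}(x)x_j$, $1\le j\le n$, where the $\mu_{ij}(x)$ are germs of holomorphic functions invariant under all $D_m$, with $\mu_{ij}(0)=\mu_{ij}$, for which the resonance equivalence of (a) holds. -/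

import Mathlib

open Filter Topology

/-! ### Formal maps of `(ℂⁿ, 0)` -/

/-- Formal maps `ℂⁿ → ℂⁿ`: `n`-tuples of formal power series in `n` variables. -/
abbrev FormalMap (n : ℕ) : Type := Fin n → MvPowerSeries (Fin n) ℂ

namespace FormalMap

variable {n : ℕ}

/-- The formal map has no constant term. -/
def FixesOrigin (f : FormalMap n) : Prop :=
  ∀ j, MvPowerSeries.constantCoeff (f j) = 0

/-- The composition `f ∘ g` (used only when `g` fixes the origin, where it is the usual one). -/
noncomputable def comp (f g : FormalMap n) : FormalMap n :=
  fun j => MvPowerSeries.subst g (f j)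

/-- The identity map. -/
noncomputable def idMap (n : ℕ) : FormalMap n := fun j => MvPowerSeries.X j

/-- The diagonal linear map `x ↦ (ν₁ x₁, …, νₙ xₙ)`. -/
noncomputable def diagMap (ν : Fin n → ℂ) : FormalMap n :=
  fun j => MvPowerSeries.C (ν j) * MvPowerSeries.X j

/-- The matrix of the linear part at the origin. -/
noncomputable def linearPart (f : FormalMap n) : Matrix (Fin n) (Fin n) ℂ :=
  Matrix.of fun j k => MvPowerSeries.coeff (Finsupp.single k 1) (f j)

/-- Formal biholomorphisms of `(ℂⁿ, 0)`: formal maps fixing the origin with a formal inverse. -/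
def IsBiholomorphism (f : FormalMap n) : Prop :=
  f.FixesOrigin ∧ ∃ g : FormalMap n, g.FixesOrigin ∧ f.comp g = idMap n ∧ g.comp f = idMap n

end FormalMap

/-! ### Holomorphic germs at the origin, given by representatives -/

/-- `F` represents a germ of biholomorphism of `(ℂⁿ, 0)` fixing the origin: it is holomorphic near
`0`, and so is a local inverse of it. -/
def IsGermOfBiholomorphism {n : ℕ} (F : (Fin n → ℂ) → (Fin n → ℂ)) : Prop :=
  AnalyticAt ℂ F 0 ∧ F 0 = 0 ∧
    ∃ G : (Fin n → ℂ) → (Fin n → ℂ), AnalyticAt ℂ G 0 ∧ G 0 = 0 ∧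
      (∀ᶠ z in 𝓝 0, F (G z) = z) ∧ (∀ᶠ z in 𝓝 0, G (F z) = z)

/-- The formal map `f` is the Taylor expansion of (the germ of) `F` at the origin: near `0`, every
component of `f` converges (absolutely) to that of `F`. -/
def HasTaylorExpansion {n : ℕ} (F : (Fin n → ℂ) → (Fin n → ℂ)) (f : FormalMap n) : Prop :=
  ∀ j, ∀ᶠ z in 𝓝 (0 : Fin n → ℂ),
    HasSum (fun Q : Fin n →₀ ℕ => MvPowerSeries.coeff Q (f j) * ∏ k, z k ^ Q k) (F z j)

/-! ### Complete integrability -/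

/-- The formal biholomorphism `Φ` transforms the family `f` into the family
`z ↦ (μ_{m1}(z) z₁, …, μ_{mn}(z) zₙ)`, where the formal power series `μ_{mj}` are invariant under
the linear parts `z ↦ (μ_{m1}(0) z₁, …, μ_{mn}(0) zₙ)` of the new family, and every resonance
between the `μ_{mj}(0)` is one between the `μ_{mj}`. -/
structure IsFormalIntegration {n ℓ : ℕ} (f : Fin ℓ → FormalMap n) (Φ : FormalMap n)
    (μ : Fin ℓ → Fin n → MvPowerSeries (Fin n) ℂ) : Prop where
  biholomorphism : Φ.IsBiholomorphism
  conjugacy : ∀ m, (f m).comp Φ = Φ.comp (fun j => μ m j * MvPowerSeries.X j)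
  invariant : ∀ m m' j,
    MvPowerSeries.subst
      (FormalMap.diagMap fun k => MvPowerSeries.constantCoeff (μ m' k)) (μ m j) = μ m j
  resonant : ∀ (j : Fin n) (Q : Fin n →₀ ℕ), 1 < Q.degree →
    ((∀ m, ∏ k, MvPowerSeries.constantCoeff (μ m k) ^ Q k
        = MvPowerSeries.constantCoeff (μ m j)) ↔
      ∀ m, ∏ k, μ m k ^ Q k = μ m j)

/-- The family of formal maps is formally completely integrable. -/
def FormallyCompletelyIntegrable {n ℓ : ℕ} (f : Fin ℓ → FormalMap n) : Prop :=
  ∃ Φ μ, IsFormalIntegration f Φ μ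

/-- The holomorphic counterpart of `IsFormalIntegration`: `Φ` is a germ of biholomorphism, the
`μ_{mj}` are germs of holomorphic functions, and the identities are identities of germs at `0`. -/
structure IsHolomorphicIntegration {n ℓ : ℕ} (F : Fin ℓ → (Fin n → ℂ) → (Fin n → ℂ))
    (Φ : (Fin n → ℂ) → (Fin n → ℂ)) (μ : Fin ℓ → Fin n → (Fin n → ℂ) → ℂ) : Prop where
  biholomorphism : IsGermOfBiholomorphism Φ
  holomorphic : ∀ m j, AnalyticAt ℂ (μ m j) 0
  conjugacy : ∀ m, ∀ᶠ z in 𝓝 0, F m (Φ z) = Φ (fun j => μ m j z * z j)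
  invariant : ∀ m m' j, ∀ᶠ z in 𝓝 0, μ m j (fun k => μ m' k 0 * z k) = μ m j z
  resonant : ∀ (j : Fin n) (Q : Fin n →₀ ℕ), 1 < Q.degree →
    ((∀ m, ∏ k, μ m k 0 ^ Q k = μ m j 0) ↔
      ∀ m, ∀ᶠ z in 𝓝 0, ∏ k, μ m k z ^ Q k = μ m j z)

/-- The family of germs is (holomorphically) completely integrable. -/
def HolomorphicallyCompletelyIntegrable {n ℓ : ℕ}
    (F : Fin ℓ → (Fin n → ℂ) → (Fin n → ℂ)) : Prop :=
  ∃ Φ μ, IsHolomorphicIntegration F Φ μ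

/-! ### Poincaré type -/

/-- The family of diagonal linear maps `diag(μ_{i1}, …, μ_{in})` is of Poincaré type. -/
def DiagonalPoincareType {n ℓ : ℕ} (μ : Fin ℓ → Fin n → ℂ) : Prop :=
  ∃ d c : ℝ, 1 < d ∧ 0 < c ∧ ∀ (j : Fin n) (Q : Fin n →₀ ℕ),
    (∃ m, ∏ k, μ m k ^ Q k ≠ μ m j) →
    ∃ (i : Fin ℓ) (Q' : Fin n →₀ ℕ),
      (∀ m, ∏ k, μ m k ^ Q' k = ∏ k, μ m k ^ Q k) ∧
      ∏ k, μ i k ^ Q' k ≠ μ i j ∧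
      c⁻¹ * d ^ Q'.degree < max ‖∏ k, μ i k ^ Q' k‖ ‖(∏ k, μ i k ^ Q' k)⁻¹‖ ∧
      (Q ≤ Q' ∨ Q' ≤ Q)

/-- A family of linear maps is of Poincaré type if it is so, as a diagonal family, in a basis of
simultaneous eigenvectors. (Two such bases differ, for the eigenvalues, by a permutation of the
coordinates only, so that the choice of the basis does not matter.) -/
def PoincareType {n ℓ : ℕ} (L : Fin ℓ → Matrix (Fin n) (Fin n) ℂ) : Prop :=
  ∃ (A : Matrix (Fin n) (Fin n) ℂ) (μ : Fin ℓ → Fin n → ℂ), IsUnit A.det ∧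
    (∀ i, L i * A = A * Matrix.diagonal (μ i)) ∧ DiagonalPoincareType μ

/-! ### Normalized maps and normal forms with respect to a diagonal linear family -/

/-- `Φ` is tangent to the identity and has no component of degree at least two along the
centralizer of the diagonal family `D = (diag(μ_{i1}, …, μ_{in}))_i`. -/
def IsNormalized {n ℓ : ℕ} (μ : Fin ℓ → Fin n → ℂ) (Φ : FormalMap n) : Prop :=
  Φ.FixesOrigin ∧ Φ.linearPart = 1 ∧
    ∀ (j : Fin n) (Q : Fin n →₀ ℕ), 2 ≤ Q.degree → (∀ i, ∏ k, μ i k ^ Q k = μ i j) →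
      MvPowerSeries.coeff Q (Φ j) = 0

/-- `Φ` transforms the family `f` into a normal form with respect to `D`: the maps
`g_i = Φ⁻¹ ∘ f_i ∘ Φ` commute with all members of the diagonal family `D`. -/
def TransformsToNormalForm {n ℓ : ℕ} (μ : Fin ℓ → Fin n → ℂ) (f : Fin ℓ → FormalMap n)
    (Φ : FormalMap n) : Prop :=
  ∃ g : Fin ℓ → FormalMap n, (∀ i, (g i).FixesOrigin) ∧
    (∀ i, (f i).comp Φ = Φ.comp (g i)) ∧
    ∀ i m, (g i).comp (FormalMap.diagMap (μ m)) = (FormalMap.diagMap (μ m)).comp (g i)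

/-! Complete integrability turns the homological equation into division by power series, and the
Poincaré condition bounds those divisions uniformly.

Any formal integration can first be normalized (`exists_normalizedIntegration`): the part `c` of `Φ`
that intertwines the two diagonal linear families conjugates the integrable normal form to one of
the same kind, because resonances are identities, and `Φ ∘ c⁻¹` is normalized. Uniqueness is a
degree-by-degree comparison of coefficients (`eq_of_isNormalized`).

Let now `f_i ∘ Φ = Φ ∘ (M_{i1} x₁, …, M_{in} xₙ)` with `Φ` normalized. By invariance, every monomial
`x^R` in a product of the `M_{ij}` has `μ_m^R = 1` for all `m`, hence `M_m^R = 1`. Sort exponents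
into classes by the tuple `(M_m^P)_m`. On the part of `Φ_j` in the class of `P`, composition with
the normal form is multiplication by the single series `M_i^P`. So this part is obtained from the
same part of the remainder `f_{ij} ∘ Φ - μ_{ij} Φ_j` through division by `M_i^P - μ_{ij}`
(`NormalizedIntegration.coeff_eq_sum`), while the resonant terms of the remainder determine `M`
(`NormalizedIntegration.norm_coeff_le`).

The Poincaré condition replaces `P` by an exponent `Q'` of the same class for which `μ_i^{Q'}` is
exponentially large or small in `|Q'|`. The divisors then have inverses of bounded weighted `ℓ¹`
norm, even after a small perturbation of the eigenvalues into the series `M_{ij}`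
(`exists_nrm_inv_le`). As the remainder is quadratic in `Φ`, its norm on radius `r` is `O(r²)`, and
for one small fixed `r` an induction on the truncation degree bounds `Φ` and `M` uniformly
(`NormalizedIntegration.converges`). -/

namespace CompleteIntegrability

open MvPowerSeries

/-! ### Monomials, truncation by degree, order of vanishing -/

/-- The monomial `a₁^{Q₁} ⋯ aₙ^{Qₙ}`. -/
def mpow {n : ℕ} {R : Type*} [CommMonoid R] (a : Fin n → R) (Q : Fin n →₀ ℕ) : R :=
  ∏ k, a k ^ Q k

section mpow

variable {n : ℕ} {R S : Type*} [CommMonoid R] [CommMonoid S]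

@[simp] lemma mpow_zero (a : Fin n → R) : mpow a 0 = 1 := by simp [mpow]

lemma mpow_add (a : Fin n → R) (P Q : Fin n →₀ ℕ) : mpow a (P + Q) = mpow a P * mpow a Q := by
  simp [mpow, pow_add, Finset.prod_mul_distrib]

lemma mpow_single (a : Fin n → R) (k : Fin n) (m : ℕ) :
    mpow a (Finsupp.single k m) = a k ^ m := by
  rw [mpow, Finset.prod_eq_single k] <;> simp +contextual [eq_comm]

lemma mpow_single_one (a : Fin n → R) (k : Fin n) : mpow a (Finsupp.single k 1) = a k := by
  rw [mpow_single, pow_one]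

lemma finsuppProd_eq_mpow (a : Fin n → R) (Q : Fin n →₀ ℕ) :
    Q.prod (fun k e => a k ^ e) = mpow a Q :=
  Finsupp.prod_fintype _ _ (by simp)

lemma map_mpow {F : Type*} [FunLike F R S] [MonoidHomClass F R S] (φ : F) (a : Fin n → R)
    (Q : Fin n →₀ ℕ) : φ (mpow a Q) = mpow (fun k => φ (a k)) Q := by
  simp [mpow, map_prod]

lemma mpow_mul (a b : Fin n → R) (Q : Fin n →₀ ℕ) :
    mpow (fun k => a k * b k) Q = mpow a Q * mpow b Q := by
  simp [mpow, mul_pow, Finset.prod_mul_distrib]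

lemma mpow_const (a : R) (Q : Fin n →₀ ℕ) : mpow (fun _ => a) Q = a ^ Q.degree := by
  simp [mpow, Finset.prod_pow_eq_pow_sum, Finsupp.degree_eq_sum]

lemma mpow_ne_zero {K : Type*} [Field K] {a : Fin n → K} (ha : ∀ k, a k ≠ 0) (Q : Fin n →₀ ℕ) :
    mpow a Q ≠ 0 :=
  Finset.prod_ne_zero_iff.2 fun k _ => pow_ne_zero _ (ha k)

lemma norm_mpow (a : Fin n → ℂ) (Q : Fin n →₀ ℕ) : ‖mpow a Q‖ = mpow (fun k => ‖a k‖) Q := by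
  simp [mpow]

end mpow

/-- The exponents of degree at most `N`. -/
noncomputable def box (n N : ℕ) : Finset (Fin n →₀ ℕ) :=
  (Finset.Iic (Finsupp.equivFunOnFinite.symm fun _ => N)).filter fun Q => Q.degree ≤ N

@[simp] lemma mem_box {n N : ℕ} {Q : Fin n →₀ ℕ} : Q ∈ box n N ↔ Q.degree ≤ N := by
  simp only [box, Finset.mem_filter, Finset.mem_Iic, and_iff_right_iff_imp]
  intro h k
  exact (Finsupp.le_degree k Q).trans h

lemma box_mono {n N N' : ℕ} (h : N ≤ N') : box n N ⊆ box n N' := fun Q hQ => by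
  simp only [mem_box] at *; omega

lemma degree_add_of_mem_antidiagonal {n : ℕ} {P : Fin n →₀ ℕ} {x : (Fin n →₀ ℕ) × (Fin n →₀ ℕ)}
    (hx : x ∈ Finset.HasAntidiagonal.antidiagonal P) : x.1.degree + x.2.degree = P.degree := by
  rw [← Finset.HasAntidiagonal.mem_antidiagonal.1 hx, map_add]

/-- All coefficients of `h` of degree less than `d` vanish. -/
def VanishBelow {n : ℕ} (d : ℕ) (h : MvPowerSeries (Fin n) ℂ) : Prop :=
  ∀ P : Fin n →₀ ℕ, P.degree < d → coeff P h = 0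

section VanishBelow

variable {n : ℕ}

lemma VanishBelow.mono {d e : ℕ} {h : MvPowerSeries (Fin n) ℂ} (hh : VanishBelow d h)
    (hed : e ≤ d) : VanishBelow e h := fun P hP => hh P (by omega)

lemma VanishBelow.add {d : ℕ} {g h : MvPowerSeries (Fin n) ℂ} (hg : VanishBelow d g)
    (hh : VanishBelow d h) : VanishBelow d (g + h) := fun P hP => by
  rw [map_add, hg P hP, hh P hP, add_zero]

lemma VanishBelow.mul {d e : ℕ} {g h : MvPowerSeries (Fin n) ℂ} (hg : VanishBelow d g)
    (hh : VanishBelow e h) : VanishBelow (d + e) (g * h) := fun P hP => by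
  classical
  rw [coeff_mul]
  refine Finset.sum_eq_zero fun x hx => ?_
  have := degree_add_of_mem_antidiagonal hx
  by_cases h1 : x.1.degree < d
  · rw [hg _ h1, zero_mul]
  · rw [hh _ (by omega), mul_zero]

lemma vanishBelow_zero (h : MvPowerSeries (Fin n) ℂ) : VanishBelow 0 h := fun P hP => by omega

lemma vanishBelow_one_iff {h : MvPowerSeries (Fin n) ℂ} :
    VanishBelow 1 h ↔ constantCoeff h = 0 := by
  constructor
  · intro hh
    rw [← coeff_zero_eq_constantCoeff_apply]
    exact hh 0 (by simp)
  · intro hh P hP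
    have : P = 0 := by simpa [Finsupp.degree_eq_zero_iff] using hP
    rw [this, coeff_zero_eq_constantCoeff_apply, hh]

lemma vanishBelow_mpow {g : FormalMap n} (hg : g.FixesOrigin) (Q : Fin n →₀ ℕ) :
    VanishBelow Q.degree (mpow g Q) := by
  induction Q using Finsupp.induction_linear with
  | zero => simpa using vanishBelow_zero _
  | add P Q hP hQ => rw [mpow_add, map_add]; exact hP.mul hQ
  | single k m =>
    rw [mpow_single, Finsupp.degree_single]
    induction m with
    | zero => exact vanishBelow_zero _
    | succ m ih => rw [pow_succ]; exact ih.mul (vanishBelow_one_iff.2 (hg k))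

/-- Telescoping: exchanging one factor at a time, the exchanged factor contributes order `M + 1` and
each of the remaining `|Q| - 1` factors order `1`. -/
lemma vanishBelow_mpow_sub {g g' : FormalMap n} (hg : g.FixesOrigin) (hg' : g'.FixesOrigin)
    {M : ℕ} (hgg : ∀ k, VanishBelow (M + 1) (g k - g' k)) (Q : Fin n →₀ ℕ) :
    VanishBelow (M + Q.degree) (mpow g Q - mpow g' Q) := by
  have key : ∀ P Q : Fin n →₀ ℕ, VanishBelow (M + P.degree) (mpow g P - mpow g' P) →
      VanishBelow (M + Q.degree) (mpow g Q - mpow g' Q) →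
      VanishBelow (M + (P + Q).degree) (mpow g (P + Q) - mpow g' (P + Q)) := by
    intro P Q hP hQ
    have e : mpow g (P + Q) - mpow g' (P + Q)
        = (mpow g P - mpow g' P) * mpow g Q + mpow g' P * (mpow g Q - mpow g' Q) := by
      rw [mpow_add, mpow_add]; ring
    rw [e, map_add]
    exact ((hP.mul (vanishBelow_mpow hg Q)).mono (by omega)).add
      (((vanishBelow_mpow hg' P).mul hQ).mono (by omega))
  induction Q using Finsupp.induction_linear with
  | zero => intro P _; simp
  | add P Q hP hQ => exact key P Q hP hQ
  | single k m =>
    induction m with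
    | zero => intro P _; simp
    | succ m ih =>
      rw [Finsupp.single_add]
      refine key _ _ ih ?_
      rw [mpow_single_one, mpow_single_one, Finsupp.degree_single]
      exact hgg k

end VanishBelow

/-! ### Coefficients of compositions of formal maps -/

section Subst

variable {n : ℕ}

lemma _root_.FormalMap.FixesOrigin.hasSubst {g : FormalMap n} (hg : g.FixesOrigin) : HasSubst g :=
  hasSubst_of_constantCoeff_zero hg

lemma subst_mpow {g : FormalMap n} (hg : g.FixesOrigin) (a : Fin n → MvPowerSeries (Fin n) ℂ)
    (Q : Fin n →₀ ℕ) : subst g (mpow a Q) = mpow (fun k => subst g (a k)) Q := by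
  rw [← coe_substAlgHom hg.hasSubst, map_mpow]

/-- `g^Q` has order at least `|Q|`, so only finitely many `Q` contribute to a given coefficient.
Substitutions are handled through this finite sum. -/
lemma coeff_subst_eq_sum_box {g : FormalMap n} (hg : g.FixesOrigin)
    (f : MvPowerSeries (Fin n) ℂ) {P : Fin n →₀ ℕ} {N : ℕ} (hP : P.degree ≤ N) :
    coeff P (subst g f) = ∑ Q ∈ box n N, coeff Q f * coeff P (mpow g Q) := by
  rw [coeff_subst hg.hasSubst, finsum_eq_sum_of_support_subset (s := box n N)]
  · simp only [finsuppProd_eq_mpow, smul_eq_mul]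
  · intro Q hQ
    rw [Function.mem_support, finsuppProd_eq_mpow] at hQ
    rw [Finset.mem_coe, mem_box]
    by_contra hlt
    exact hQ (by rw [vanishBelow_mpow hg Q P (by omega), smul_zero])

lemma degree_eq_one {Q : Fin n →₀ ℕ} (hQ : Q.degree = 1) : ∃ k, Q = Finsupp.single k 1 := by
  have hne : Q ≠ 0 := by rintro rfl; simp at hQ
  obtain ⟨k, hk⟩ := Finsupp.ne_iff.1 hne
  have hle : Finsupp.single k 1 ≤ Q := by
    rw [Finsupp.single_le_iff]; exact Nat.one_le_iff_ne_zero.2 hk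
  obtain ⟨R, rfl⟩ := le_iff_exists_add.1 hle
  rw [map_add, Finsupp.degree_single] at hQ
  have : R = 0 := by rw [← Finsupp.degree_eq_zero_iff]; omega
  exact ⟨k, by rw [this, add_zero]⟩

lemma sum_box_eq_sum_single {N : ℕ} (hN : 1 ≤ N) (F : (Fin n →₀ ℕ) → ℂ)
    (hF : ∀ Q : Fin n →₀ ℕ, Q.degree ≠ 1 → F Q = 0) :
    ∑ Q ∈ box n N, F Q = ∑ k, F (Finsupp.single k 1) := by
  classical
  have hinj : Function.Injective fun k : Fin n => Finsupp.single k 1 :=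
    Finsupp.single_left_injective one_ne_zero
  rw [← Finset.sum_image (f := F) (g := fun k : Fin n => Finsupp.single k 1)
    (fun a _ b _ h => hinj h)]
  symm
  refine Finset.sum_subset ?_ ?_
  · intro Q hQ
    obtain ⟨k, -, rfl⟩ := Finset.mem_image.1 hQ
    simpa using hN
  · intro Q _ hQ
    refine hF Q fun h1 => hQ ?_
    obtain ⟨k, rfl⟩ := degree_eq_one h1
    exact Finset.mem_image_of_mem _ (Finset.mem_univ k)

/-- If two formal maps agree in degrees at most `M`, the terms of degree `M + 1` of `f ∘ g` and
`f ∘ g'` differ by the linear part of `f` applied to the difference of `g` and `g'`. -/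
lemma coeff_subst_sub_coeff_subst {g g' : FormalMap n} (hg : g.FixesOrigin)
    (hg' : g'.FixesOrigin) {M : ℕ} (hgg : ∀ k, VanishBelow (M + 1) (g k - g' k))
    (f : MvPowerSeries (Fin n) ℂ) {P : Fin n →₀ ℕ} (hP : P.degree = M + 1) :
    coeff P (subst g f) - coeff P (subst g' f)
      = ∑ k, coeff (Finsupp.single k 1) f * (coeff P (g k) - coeff P (g' k)) := by
  rw [coeff_subst_eq_sum_box hg f hP.le, coeff_subst_eq_sum_box hg' f hP.le,
    ← Finset.sum_sub_distrib, sum_box_eq_sum_single (by omega)]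
  · simp [mpow_single_one, mul_sub]
  · intro Q hQ
    rw [← mul_sub]
    rcases Nat.lt_or_ge Q.degree 1 with h0 | h2
    · have : Q = 0 := by simpa [Finsupp.degree_eq_zero_iff] using h0
      simp [this]
    · rw [← map_sub, vanishBelow_mpow_sub hg hg' hgg Q P (by omega), mul_zero]

/-- Without linear terms in `f` one degree is gained. This gain drives the induction in the
convergence proof. -/
lemma coeff_subst_congr {g g' : FormalMap n} (hg : g.FixesOrigin)
    (hg' : g'.FixesOrigin) {M : ℕ} (hgg : ∀ k, VanishBelow (M + 1) (g k - g' k))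
    {f : MvPowerSeries (Fin n) ℂ} (hf : VanishBelow 2 f) {P : Fin n →₀ ℕ} (hP : P.degree ≤ M + 1) :
    coeff P (subst g f) = coeff P (subst g' f) := by
  rw [coeff_subst_eq_sum_box hg f hP, coeff_subst_eq_sum_box hg' f hP, ← sub_eq_zero,
    ← Finset.sum_sub_distrib]
  refine Finset.sum_eq_zero fun Q _ => ?_
  rw [← mul_sub]
  by_cases h2 : Q.degree < 2
  · rw [hf Q h2, zero_mul]
  · rw [← map_sub, vanishBelow_mpow_sub hg hg' hgg Q P (by omega), mul_zero]

lemma vanishBelow_subst {g : FormalMap n} (hg : g.FixesOrigin) {f : MvPowerSeries (Fin n) ℂ}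
    {d : ℕ} (hf : VanishBelow d f) : VanishBelow d (subst g f) := fun P hP => by
  rw [coeff_subst_eq_sum_box hg f le_rfl]
  refine Finset.sum_eq_zero fun Q hQ => ?_
  rw [hf Q (by rw [mem_box] at hQ; omega), zero_mul]

lemma X_eq (k : Fin n) : (X k : MvPowerSeries (Fin n) ℂ) = monomial (Finsupp.single k 1) 1 := rfl

lemma mpow_X (Q : Fin n →₀ ℕ) :
    mpow (fun k => (X k : MvPowerSeries (Fin n) ℂ)) Q = monomial Q 1 := by
  rw [← finsuppProd_eq_mpow, monomial_one_eq]

/-- The coefficients of `h(M₁ x₁, …, Mₙ xₙ)`. -/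
lemma coeff_subst_mul_X (M : Fin n → MvPowerSeries (Fin n) ℂ) (h : MvPowerSeries (Fin n) ℂ)
    (P : Fin n →₀ ℕ) :
    coeff P (subst (fun k => M k * X k) h)
      = ∑ x ∈ Finset.HasAntidiagonal.antidiagonal P, coeff x.2 h * coeff x.1 (mpow M x.2) := by
  classical
  have hM : FormalMap.FixesOrigin (fun k => M k * X k) := fun k => by simp
  rw [coeff_subst_eq_sum_box hM h le_rfl]
  have : ∀ Q ∈ box n P.degree, coeff Q h * coeff P (mpow (fun k => M k * X k) Q)
      = ∑ x ∈ Finset.HasAntidiagonal.antidiagonal P,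
          if Q = x.2 then coeff x.2 h * coeff x.1 (mpow M x.2) else 0 := by
    intro Q _
    rw [mpow_mul, mpow_X, coeff_mul, Finset.mul_sum]
    refine Finset.sum_congr rfl fun x _ => ?_
    rw [coeff_monomial]
    by_cases hx : Q = x.2
    · subst hx; simp
    · rw [if_neg (Ne.symm hx), if_neg hx, mul_zero, mul_zero]
  rw [Finset.sum_congr rfl this, Finset.sum_comm]
  refine Finset.sum_congr rfl fun x hx => ?_
  rw [Finset.sum_ite_eq', if_pos]
  rw [mem_box]
  have := degree_add_of_mem_antidiagonal hx
  omega

lemma diagMap_fixesOrigin (ν : Fin n → ℂ) : (FormalMap.diagMap ν).FixesOrigin := fun k => by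
  simp [FormalMap.diagMap]

lemma mpow_C (ν : Fin n → ℂ) (Q : Fin n →₀ ℕ) :
    mpow (fun k => (C (ν k) : MvPowerSeries (Fin n) ℂ)) Q = C (mpow ν Q) :=
  (map_mpow C ν Q).symm

lemma mpow_diagMap (ν : Fin n → ℂ) (Q : Fin n →₀ ℕ) :
    mpow (FormalMap.diagMap ν) Q = C (mpow ν Q) * monomial Q 1 := by
  unfold FormalMap.diagMap
  rw [mpow_mul, mpow_X, mpow_C]

lemma coeff_subst_diagMap (ν : Fin n → ℂ) (h : MvPowerSeries (Fin n) ℂ) (P : Fin n →₀ ℕ) :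
    coeff P (subst (FormalMap.diagMap ν) h) = mpow ν P * coeff P h := by
  classical
  rw [coeff_subst_eq_sum_box (diagMap_fixesOrigin ν) h le_rfl, Finset.sum_eq_single P]
  · rw [mpow_diagMap, coeff_C_mul, coeff_monomial_same]; ring
  · intro Q _ hQ
    rw [mpow_diagMap, coeff_C_mul, coeff_monomial_ne (Ne.symm hQ)]; ring
  · intro h; simp at h

/-- The leading terms of a composition with a map whose linear part is diagonal. -/
lemma coeff_subst_of_vanishBelow {g : FormalMap n} (hg : g.FixesOrigin) {ν : Fin n → ℂ}
    (hν : g.linearPart = Matrix.diagonal ν) {h : MvPowerSeries (Fin n) ℂ} {N : ℕ}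
    (hh : VanishBelow N h) {P : Fin n →₀ ℕ} (hP : P.degree = N) :
    coeff P (subst g h) = mpow ν P * coeff P h := by
  rw [← coeff_subst_diagMap, coeff_subst_eq_sum_box hg h hP.le,
    coeff_subst_eq_sum_box (diagMap_fixesOrigin ν) h hP.le, ← sub_eq_zero,
    ← Finset.sum_sub_distrib]
  refine Finset.sum_eq_zero fun Q _ => ?_
  rw [← mul_sub]
  by_cases h2 : Q.degree < N
  · rw [hh Q h2, zero_mul]
  -- `g` and its linear part agree through degree one, hence their monomials with exponent `Q` agree
  -- through degree `|Q|`.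
  · rw [← map_sub, vanishBelow_mpow_sub (M := 1) hg (diagMap_fixesOrigin ν) ?_ Q P (by omega),
      mul_zero]
    intro k R hR
    rcases Nat.lt_or_ge R.degree 1 with h0 | h1
    · have : R = 0 := by simpa [Finsupp.degree_eq_zero_iff] using h0
      subst this
      rw [coeff_zero_eq_constantCoeff_apply, map_sub, hg k, diagMap_fixesOrigin ν k, sub_zero]
    · obtain ⟨i, rfl⟩ := degree_eq_one (by omega : R.degree = 1)
      have e := congrFun (congrFun hν k) i
      classical
      simp only [FormalMap.linearPart, Matrix.of_apply, Matrix.diagonal_apply] at e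
      rw [map_sub, e, FormalMap.diagMap, coeff_C_mul, coeff_index_single_X]
      by_cases hki : k = i
      · simp [hki]
      · simp [hki, Ne.symm hki]

lemma comp_fixesOrigin {f g : FormalMap n} (hf : f.FixesOrigin) (hg : g.FixesOrigin) :
    (f.comp g).FixesOrigin := fun k =>
  vanishBelow_one_iff.1 (vanishBelow_subst hg (vanishBelow_one_iff.2 (hf k)))

lemma linearPart_comp {f g : FormalMap n} (hg : g.FixesOrigin) :
    (f.comp g).linearPart = f.linearPart * g.linearPart := by
  ext j k
  have h0 : FormalMap.FixesOrigin (0 : FormalMap n) := fun k => by simp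
  -- The linear term is read off by comparing `g` with the zero map, with which it agrees in degree
  -- zero.
  have := coeff_subst_sub_coeff_subst hg h0 (M := 0)
    (fun k => by simpa [vanishBelow_one_iff] using hg k) (f j) (P := Finsupp.single k 1) (by simp)
  have hz : coeff (Finsupp.single k 1) (subst (0 : FormalMap n) (f j)) = 0 := by
    rw [coeff_subst_eq_sum_box h0 _ (N := 1) (by simp), sum_box_eq_sum_single le_rfl]
    · simp [mpow_single_one]
    · intro Q hQ
      rcases Nat.lt_or_ge Q.degree 1 with h1 | h1
      · have : Q = 0 := by simpa [Finsupp.degree_eq_zero_iff] using h1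
        subst this
        rw [mpow_zero, coeff_one, if_neg (by simp), mul_zero]
      · rw [vanishBelow_mpow h0 Q _ (by rw [Finsupp.degree_single]; omega), mul_zero]
  rw [hz] at this
  simpa [FormalMap.linearPart, FormalMap.comp, Matrix.mul_apply] using this

lemma comp_assoc {f g h : FormalMap n} (hg : g.FixesOrigin) (hh : h.FixesOrigin) :
    (f.comp g).comp h = f.comp (g.comp h) := by
  funext j
  exact subst_comp_subst_apply hg.hasSubst hh.hasSubst (f j)

lemma comp_idMap (f : FormalMap n) : f.comp (FormalMap.idMap n) = f := by
  funext j
  exact congrFun subst_self (f j)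

lemma idMap_comp {f : FormalMap n} (hf : f.FixesOrigin) : (FormalMap.idMap n).comp f = f := by
  funext j
  exact subst_X hf.hasSubst j

lemma idMap_fixesOrigin : (FormalMap.idMap n).FixesOrigin := fun k => by
  simp [FormalMap.idMap]

lemma linearPart_diagMap (ν : Fin n → ℂ) :
    (FormalMap.diagMap ν).linearPart = Matrix.diagonal ν := by
  classical
  ext j k
  simp only [FormalMap.linearPart, FormalMap.diagMap, Matrix.of_apply, coeff_C_mul,
    coeff_index_single_X, Matrix.diagonal_apply]
  split_ifs <;> simp_all

lemma linearPart_idMap : (FormalMap.idMap n).linearPart = 1 := by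
  classical
  ext j k
  simp only [FormalMap.linearPart, FormalMap.idMap, Matrix.of_apply,
    coeff_index_single_X, Matrix.one_apply]
  split_ifs <;> simp_all

end Subst

/-! ### Formal inverse function theorem -/

section Inverse

variable {n : ℕ}

lemma vanishBelow_one_sub {g g' : FormalMap n} (hg : g.FixesOrigin) (hg' : g'.FixesOrigin)
    (k : Fin n) : VanishBelow 1 (g k - g' k) := by
  rw [vanishBelow_one_iff, map_sub, hg k, hg' k, sub_zero]

/-- One step of the iteration `g ↦ g + B (id - c ∘ g)` that solves `c ∘ g = id`. -/
noncomputable def inverseStep (B : Matrix (Fin n) (Fin n) ℂ) (c g : FormalMap n) : FormalMap n :=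
  fun j => g j + ∑ i, C (B j i) * (X i - subst g (c i))

lemma inverseStep_fixesOrigin (B : Matrix (Fin n) (Fin n) ℂ) {c g : FormalMap n}
    (hc : c.FixesOrigin) (hg : g.FixesOrigin) : (inverseStep B c g).FixesOrigin := fun j => by
  have : ∀ i, constantCoeff (subst g (c i)) = 0 := comp_fixesOrigin hc hg
  simp [inverseStep, hg j, this]

/-- The step is a contraction in the adic sense: in the lowest degree where `g` and `g'` may differ,
`B` times the linear part of `c` is the identity and cancels the difference. -/
lemma vanishBelow_inverseStep_sub {B : Matrix (Fin n) (Fin n) ℂ} {c g g' : FormalMap n}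
    (hB : B * c.linearPart = 1) (hg : g.FixesOrigin) (hg' : g'.FixesOrigin)
    (hc : c.FixesOrigin) {M : ℕ} (hgg : ∀ k, VanishBelow (M + 1) (g k - g' k)) (j : Fin n) :
    VanishBelow (M + 2) (inverseStep B c g j - inverseStep B c g' j) := by
  intro P hP
  rcases Nat.eq_zero_or_pos P.degree with h0 | hpos
  · exact vanishBelow_one_sub (inverseStep_fixesOrigin B hc hg)
      (inverseStep_fixesOrigin B hc hg') j P (by omega)
  obtain ⟨m, hm⟩ : ∃ m, P.degree = m + 1 := ⟨P.degree - 1, by omega⟩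
  have hdiff := fun i => coeff_subst_sub_coeff_subst hg hg'
    (fun k => (hgg k).mono (by omega : m + 1 ≤ M + 1)) (c i) hm
  have hexp : coeff P (inverseStep B c g j - inverseStep B c g' j)
      = (coeff P (g j) - coeff P (g' j))
        - ∑ i, B j i * (coeff P (subst g (c i)) - coeff P (subst g' (c i))) := by
    simp only [inverseStep, map_sub, map_add, map_sum, coeff_C_mul, mul_sub,
      Finset.sum_sub_distrib]
    ring
  rw [hexp]
  simp only [hdiff]
  have hmul : ∑ i, B j i * ∑ k, coeff (Finsupp.single k 1) (c i)
        * (coeff P (g k) - coeff P (g' k))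
      = ∑ k, (B * c.linearPart) j k * (coeff P (g k) - coeff P (g' k)) := by
    simp only [Matrix.mul_apply, Finset.mul_sum, Finset.sum_mul]
    rw [Finset.sum_comm]
    exact Finset.sum_congr rfl fun k _ => Finset.sum_congr rfl fun i _ => by
      simp [FormalMap.linearPart]; ring
  rw [hmul, hB]
  simp [Matrix.one_apply]

lemma exists_comp_eq_idMap {c : FormalMap n} (hc : c.FixesOrigin)
    {B : Matrix (Fin n) (Fin n) ℂ} (hB : B * c.linearPart = 1) :
    ∃ g : FormalMap n, g.FixesOrigin ∧ c.comp g = FormalMap.idMap n := by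
  let G : ℕ → FormalMap n := fun k => (inverseStep B c)^[k] 0
  have hGs : ∀ k, G (k + 1) = inverseStep B c (G k) := fun k =>
    Function.iterate_succ_apply' _ _ _
  have hG : ∀ k, (G k).FixesOrigin := by
    intro k
    induction k with
    | zero => intro j; simp [G]
    | succ k ih => rw [hGs]; exact inverseStep_fixesOrigin B hc ih
  have hstep : ∀ k j, VanishBelow (k + 1) (G (k + 1) j - G k j) := by
    intro k
    induction k with
    | zero => exact fun j => vanishBelow_one_sub (hG _) (hG _) j
    | succ k ih =>
      intro j
      rw [hGs (k + 1)]
      conv => enter [2, 2]; rw [hGs k]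
      exact vanishBelow_inverseStep_sub hB (hG _) (hG _) hc ih j
  have hfar : ∀ k l j, VanishBelow (k + 1) (G (k + l) j - G k j) := by
    intro k l j
    induction l with
    | zero => intro P _; simp
    | succ l ih =>
      have : G (k + (l + 1)) j - G k j
          = (G (k + l + 1) j - G (k + l) j) + (G (k + l) j - G k j) := by
        rw [← add_assoc]; ring
      rw [this]
      exact ((hstep (k + l) j).mono (by omega)).add ih
  -- The limit of the iteration: from stage `|P|` on, the coefficient of `x^P` no longer changes.
  let g : FormalMap n := fun j P => coeff P (G P.degree j)
  have hg : ∀ k j, VanishBelow (k + 1) (g j - G k j) := by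
    intro k j P hP
    have := hfar P.degree (k - P.degree) j P (by omega)
    rw [show P.degree + (k - P.degree) = k by omega, map_sub] at this
    rw [map_sub, coeff_apply, sub_eq_zero]
    exact (sub_eq_zero.1 this).symm
  have hg0 : g.FixesOrigin := fun j => by
    have := vanishBelow_one_iff.1 (hg 0 j)
    rw [map_sub, hG 0 j, sub_zero] at this
    exact this
  refine ⟨g, hg0, ?_⟩
  have hfix : ∀ j, inverseStep B c g j = g j := by
    intro j
    rw [← sub_eq_zero]
    refine MvPowerSeries.ext fun P => ?_
    have h1 := vanishBelow_inverseStep_sub hB hg0 (hG P.degree) hc (hg P.degree) j P (by omega)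
    have h2 := hg (P.degree + 1) j P (by omega)
    rw [hGs] at h2
    rw [map_sub] at h1 h2 ⊢
    rw [map_zero]
    linear_combination h1 - h2
  have hsum : ∀ j, ∑ i, C (B j i) * (X i - subst g (c i)) = 0 := fun j => by
    have := hfix j
    rwa [inverseStep, add_eq_left] at this
  -- The fixed-point equation says only that `B (id - c ∘ g) = 0`; applying the linear part of `c`
  -- removes `B`.
  have hB' : c.linearPart * B = 1 := mul_eq_one_comm.1 hB
  funext l
  refine (sub_eq_zero.1 ?_).symm
  have : ∑ j, C (c.linearPart l j) * ∑ i, C (B j i) * (X i - subst g (c i))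
      = ∑ i, C ((c.linearPart * B) l i) * (X i - subst g (c i)) := by
    simp only [Matrix.mul_apply, Finset.mul_sum, map_sum, Finset.sum_mul, map_mul, mul_assoc]
    rw [Finset.sum_comm]
  rw [hB'] at this
  simp only [hsum, mul_zero, Finset.sum_const_zero] at this
  rw [Finset.sum_eq_single l] at this
  · simpa [FormalMap.idMap, FormalMap.comp] using this.symm
  · intro i _ hi
    simp [Matrix.one_apply_ne (Ne.symm hi)]
  · simp

/-- The formal inverse function theorem. -/
lemma exists_formal_inverse {c : FormalMap n} (hc : c.FixesOrigin)
    {B : Matrix (Fin n) (Fin n) ℂ} (hB : c.linearPart * B = 1) :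
    ∃ g : FormalMap n, g.FixesOrigin ∧ c.comp g = FormalMap.idMap n ∧
      g.comp c = FormalMap.idMap n := by
  obtain ⟨g, hg, hcg⟩ := exists_comp_eq_idMap hc (mul_eq_one_comm.1 hB)
  have hlin : c.linearPart * g.linearPart = 1 := by
    rw [← linearPart_comp hg, hcg, linearPart_idMap]
  -- The right inverse `g` has a right inverse in turn, which must be `c`.
  obtain ⟨c', hc', hgc⟩ := exists_comp_eq_idMap hg hlin
  have : c' = c := by
    rw [← idMap_comp hc', ← hcg, comp_assoc hg hc', hgc, comp_idMap]
  exact ⟨g, hg, hcg, this ▸ hgc⟩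

end Inverse

/-! ### Uniqueness of the normalized transformation -/

section Uniqueness

variable {n ℓ : ℕ}

lemma resonant_of_commute {μ : Fin ℓ → Fin n → ℂ} {g : FormalMap n} (hg : g.FixesOrigin)
    (h : ∀ m, g.comp (FormalMap.diagMap (μ m)) = (FormalMap.diagMap (μ m)).comp g)
    {j : Fin n} {P : Fin n →₀ ℕ} (hP : coeff P (g j) ≠ 0) (m : Fin ℓ) : mpow (μ m) P = μ m j := by
  have := congrArg (coeff P) (congrFun (h m) j)
  simp only [FormalMap.comp] at this
  rw [coeff_subst_diagMap, FormalMap.diagMap, subst_mul hg.hasSubst, subst_X hg.hasSubst,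
    show (C (μ m j) : MvPowerSeries (Fin n) ℂ) = algebraMap ℂ _ (μ m j) from rfl,
    ← coe_substAlgHom hg.hasSubst, AlgHom.commutes] at this
  rw [show (algebraMap ℂ (MvPowerSeries (Fin n) ℂ) (μ m j)) = C (μ m j) from rfl,
    coeff_C_mul] at this
  exact mul_right_cancel₀ hP this

/-- A normalized map that transforms the family into a normal form is unique. -/
lemma eq_of_isNormalized {μ : Fin ℓ → Fin n → ℂ} {f : Fin ℓ → FormalMap n}
    (hlin : ∀ i, (f i).linearPart = Matrix.diagonal (μ i)) {Φ Ψ : FormalMap n}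
    (hΦ : IsNormalized μ Φ) (hΦf : TransformsToNormalForm μ f Φ)
    (hΨ : IsNormalized μ Ψ) (hΨf : TransformsToNormalForm μ f Ψ) : Ψ = Φ := by
  obtain ⟨g, hg0, hg, hgD⟩ := hΦf
  obtain ⟨g', hg0', hg', hgD'⟩ := hΨf
  have hlg : ∀ i, (g i).linearPart = Matrix.diagonal (μ i) := fun i => by
    have := congrArg FormalMap.linearPart (hg i)
    rwa [linearPart_comp hΦ.1, linearPart_comp (hg0 i), hlin, hΦ.2.1, one_mul, mul_one,
      eq_comm] at this
  -- The transformations and the normal forms are compared together, degree by degree.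
  have key : ∀ N, (∀ j, VanishBelow N (Φ j - Ψ j)) ∧ ∀ i j, VanishBelow N (g i j - g' i j) := by
    intro N
    induction N with
    | zero => exact ⟨fun j => vanishBelow_zero _, fun i j => vanishBelow_zero _⟩
    | succ N ih =>
      rcases N with _ | M
      · exact ⟨vanishBelow_one_sub hΦ.1 hΨ.1, fun i => vanishBelow_one_sub (hg0 i) (hg0' i)⟩
      -- The linearized conjugacy equation in the first degree not yet compared: `(μ_{ij} - μ_i^P)
      -- ΔΦ = Δg`.
      have hmain : ∀ i j (P : Fin n →₀ ℕ), P.degree = M + 1 →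
          μ i j * (coeff P (Φ j) - coeff P (Ψ j))
            = mpow (μ i) P * (coeff P (Φ j) - coeff P (Ψ j))
              + (coeff P (g i j) - coeff P (g' i j)) := by
        intro i j P hP
        have h1 := coeff_subst_sub_coeff_subst hΦ.1 hΨ.1 ih.1 (f i j) hP
        have h2 := coeff_subst_sub_coeff_subst (hg0 i) (hg0' i) (ih.2 i) (Ψ j) hP
        have h3 := coeff_subst_of_vanishBelow (hg0 i) (hlg i) (ih.1 j) hP
        have e1 : ∀ k, coeff (Finsupp.single k 1) (f i j) = Matrix.diagonal (μ i) j k := fun k =>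
          congrFun (congrFun (hlin i) j) k
        have e2 : ∀ k, coeff (Finsupp.single k 1) (Ψ j)
            = (1 : Matrix (Fin n) (Fin n) ℂ) j k := fun k =>
          congrFun (congrFun hΨ.2.1 j) k
        have e3 : subst Φ (f i j) = subst (g i) (Φ j) := congrFun (hg i) j
        have e4 : subst Ψ (f i j) = subst (g' i) (Ψ j) := congrFun (hg' i) j
        simp only [e1, e2, Matrix.diagonal_apply, Matrix.one_apply, ite_mul, zero_mul, one_mul,
          Finset.sum_ite_eq, Finset.mem_univ, if_true] at h1 h2
        rw [subst_sub (hg0 i).hasSubst, map_sub, map_sub] at h3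
        rw [e3, e4] at h1
        linear_combination h3 + h2 - h1
      have hΔ : ∀ j (P : Fin n →₀ ℕ), P.degree = M + 1 → coeff P (Φ j) - coeff P (Ψ j) = 0 := by
        intro j P hP
        -- At a resonant `P` normalization fixes the coefficient of both maps (in degree one,
        -- tangency to the identity does). At a nonresonant `P` both normal forms have coefficient
        -- zero, so the divisor can be cancelled.
        by_cases hres : ∀ m, mpow (μ m) P = μ m j
        · rcases Nat.eq_zero_or_pos M with h0 | hpos
          · obtain ⟨k, rfl⟩ := degree_eq_one (by omega : P.degree = 1)
            have e1 := congrFun (congrFun hΦ.2.1 j) k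
            have e2 := congrFun (congrFun hΨ.2.1 j) k
            simp only [FormalMap.linearPart, Matrix.of_apply] at e1 e2
            rw [e1, e2, sub_self]
          · rw [hΦ.2.2 j P (by omega) hres, hΨ.2.2 j P (by omega) hres, sub_self]
        · obtain ⟨m, hm⟩ := not_forall.1 hres
          have h1 : coeff P (g m j) = 0 := by
            by_contra h
            exact hres (resonant_of_commute (hg0 m) (hgD m) h)
          have h2 : coeff P (g' m j) = 0 := by
            by_contra h
            exact hres (resonant_of_commute (hg0' m) (hgD' m) h)
          have := hmain m j P hP
          rw [h1, h2, sub_zero, add_zero] at this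
          by_contra hne
          exact hm (mul_right_cancel₀ hne this).symm
      constructor
      · intro j P hP
        rcases Nat.lt_or_ge P.degree (M + 1) with h | h
        · exact ih.1 j P h
        · rw [map_sub]; exact hΔ j P (by omega)
      · intro i j P hP
        rcases Nat.lt_or_ge P.degree (M + 1) with h | h
        · exact ih.2 i j P h
        · have := hmain i j P (by omega)
          rw [hΔ j P (by omega), mul_zero, mul_zero, zero_add] at this
          rw [map_sub, ← this]
  funext j
  refine MvPowerSeries.ext fun P => ?_
  have := (key (P.degree + 1)).1 j P (by omega)
  rw [map_sub] at this
  exact (sub_eq_zero.1 this).symm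

end Uniqueness

/-! ### From a formal integration to a normalized one -/

section Normalization

variable {n ℓ : ℕ}

lemma mpow_comp {R : Type*} [CommMonoid R] (a : Fin n → R) (σ : Fin n → Fin n)
    (Q : Fin n →₀ ℕ) : mpow (fun j => a (σ j)) Q = mpow a (Q.mapDomain σ) := by
  induction Q using Finsupp.induction_linear with
  | zero => simp
  | add P Q hP hQ => rw [mpow_add, Finsupp.mapDomain_add, mpow_add, hP, hQ]
  | single k m => rw [Finsupp.mapDomain_single, mpow_single, mpow_single]

lemma linearPart_mul_X (M : Fin n → MvPowerSeries (Fin n) ℂ) :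
    FormalMap.linearPart (fun j => M j * X j)
      = Matrix.diagonal fun j => constantCoeff (M j) := by
  classical
  ext j k
  simp only [FormalMap.linearPart, Matrix.of_apply, X_eq]
  rw [coeff_mul_monomial, Matrix.diagonal_apply]
  by_cases h : j = k
  · subst h; simp
  · rw [if_neg, if_neg h]
    intro hle
    have := hle j
    simp [Ne.symm h] at this

lemma mul_X_fixesOrigin (M : Fin n → MvPowerSeries (Fin n) ℂ) :
    FormalMap.FixesOrigin fun j => M j * X j := fun j => by simp

variable {f : Fin ℓ → FormalMap n} {Φ : FormalMap n}
  {μ : Fin ℓ → Fin n → MvPowerSeries (Fin n) ℂ}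

lemma constantCoeff_mpow (a : Fin n → MvPowerSeries (Fin n) ℂ) (Q : Fin n →₀ ℕ) :
    constantCoeff (mpow a Q) = mpow (fun k => constantCoeff (a k)) Q :=
  map_mpow constantCoeff a Q

lemma ne_zero_of_constantCoeff_ne_zero {h : MvPowerSeries (Fin n) ℂ}
    (hh : constantCoeff h ≠ 0) : h ≠ 0 := fun h0 => hh (by rw [h0, map_zero])

/-- For `R ≠ 0` the exponent `R + e_k` is a resonance of degree greater than one for the index `k`;
the factor `μ_{mk}` then cancels. -/
lemma mpow_eq_one_of_resonant (h0 : ∀ m k, constantCoeff (μ m k) ≠ 0)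
    (hres : ∀ (j : Fin n) (Q : Fin n →₀ ℕ), 1 < Q.degree →
      (∀ m, mpow (fun k => constantCoeff (μ m k)) Q = constantCoeff (μ m j)) →
      ∀ m, mpow (μ m) Q = μ m j) {R : Fin n →₀ ℕ}
    (hR : ∀ m, mpow (fun k => constantCoeff (μ m k)) R = 1) (m : Fin ℓ) : mpow (μ m) R = 1 := by
  by_cases hR0 : R = 0
  · rw [hR0, mpow_zero]
  obtain ⟨k, -⟩ := Finsupp.ne_iff.1 hR0
  have hdeg : R.degree ≠ 0 := by rwa [ne_eq, Finsupp.degree_eq_zero_iff]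
  have := hres k (R + Finsupp.single k 1)
    (by rw [map_add, Finsupp.degree_single]; omega)
    (fun m => by rw [mpow_add, hR, mpow_single_one, one_mul]) m
  rw [mpow_add, mpow_single_one] at this
  exact mul_right_cancel₀ (ne_zero_of_constantCoeff_ne_zero (h0 m k)) (by rw [this, one_mul])

lemma mpow_eq_one_of_coeff_ne_zero {ν : Fin ℓ → Fin n → ℂ} {h : MvPowerSeries (Fin n) ℂ}
    (hinv : ∀ m, subst (FormalMap.diagMap (ν m)) h = h) {R : Fin n →₀ ℕ} (hR : coeff R h ≠ 0)
    (m : Fin ℓ) : mpow (ν m) R = 1 := by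
  have := congrArg (coeff R) (hinv m)
  rw [coeff_subst_diagMap] at this
  exact mul_right_cancel₀ hR (by rw [this, one_mul])

/-- In an integrable normal form the resonances of degree one are also identities. -/
lemma _root_.IsFormalIntegration.mpow_eq (h : IsFormalIntegration f Φ μ)
    (h0 : ∀ m k, constantCoeff (μ m k) ≠ 0) {j : Fin n} {Q : Fin n →₀ ℕ} (hQ : 1 ≤ Q.degree)
    (hres : ∀ m, mpow (fun k => constantCoeff (μ m k)) Q = constantCoeff (μ m j)) (m : Fin ℓ) :
    mpow (μ m) Q = μ m j := by
  have hres2 : ∀ (j : Fin n) (Q : Fin n →₀ ℕ), 1 < Q.degree →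
      (∀ m, mpow (fun k => constantCoeff (μ m k)) Q = constantCoeff (μ m j)) →
      ∀ m, mpow (μ m) Q = μ m j := fun j Q hQ hr => (h.resonant j Q hQ).1 hr
  rcases Nat.lt_or_ge 1 Q.degree with h2 | h1
  · exact hres2 j Q h2 hres m
  obtain ⟨k, rfl⟩ := degree_eq_one (by omega : Q.degree = 1)
  -- The definition covers only degrees above one. If some `R ≠ 0` has weight `1`, adding it raises
  -- the degree; otherwise invariance forces all the series to be constant.
  by_cases hR : ∃ R : Fin n →₀ ℕ, R ≠ 0 ∧ ∀ m, mpow (fun k => constantCoeff (μ m k)) R = 1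
  · obtain ⟨R, hR0, hR⟩ := hR
    have hdeg : R.degree ≠ 0 := by rwa [ne_eq, Finsupp.degree_eq_zero_iff]
    have := hres2 j (R + Finsupp.single k 1)
      (by rw [map_add, Finsupp.degree_single]; omega)
      (fun m => by rw [mpow_add, hR, one_mul, hres]) m
    rwa [mpow_add, mpow_eq_one_of_resonant h0 hres2 hR, one_mul] at this
  · push Not at hR
    have hconst : ∀ k, μ m k = C (constantCoeff (μ m k)) := by
      intro k
      classical
      refine MvPowerSeries.ext fun R => ?_
      rw [coeff_C]
      split_ifs with hR0
      · rw [hR0, coeff_zero_eq_constantCoeff_apply]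
      · by_contra hne
        obtain ⟨m', hm'⟩ := hR R hR0
        exact hm' (mpow_eq_one_of_coeff_ne_zero (fun m' => h.invariant m m' k) hne m')
    have := hres m
    rw [mpow_single_one] at this ⊢
    rw [hconst k, hconst j, this]

lemma subst_C' {g : FormalMap n} (hg : g.FixesOrigin) (a : ℂ) :
    subst g (C a : MvPowerSeries (Fin n) ℂ) = C a := by
  rw [show (C a : MvPowerSeries (Fin n) ℂ) = algebraMap ℂ _ a from rfl,
    ← coe_substAlgHom hg.hasSubst, AlgHom.commutes]

lemma constantCoeff_subst' {g : FormalMap n} (hg : g.FixesOrigin) (h : MvPowerSeries (Fin n) ℂ) :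
    constantCoeff (subst g h) = constantCoeff h := by
  rw [← coeff_zero_eq_constantCoeff_apply, coeff_subst_eq_sum_box hg h (N := 0) (by simp),
    Finset.sum_eq_single 0]
  · simp
  · intro Q hQ hQ0
    rw [mem_box, Nat.le_zero, Finsupp.degree_eq_zero_iff] at hQ
    exact absurd hQ hQ0
  · intro h; simp at h

/-- A formal map with `f_i ∘ Φ = Φ ∘ (M_{i1} x₁, …, M_{in} xₙ)` that is normalized with respect to
the diagonal linear parts. -/
structure NormalizedIntegration (μ : Fin ℓ → Fin n → ℂ) (f : Fin ℓ → FormalMap n)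
    (Φ : FormalMap n) (M : Fin ℓ → Fin n → MvPowerSeries (Fin n) ℂ) : Prop where
  normalized : IsNormalized μ Φ
  conjugacy : ∀ i, (f i).comp Φ = Φ.comp (fun j => M i j * X j)
  constantCoeff_eq : ∀ i j, constantCoeff (M i j) = μ i j
  invariant : ∀ i j m, subst (FormalMap.diagMap (μ m)) (M i j) = M i j
  resonant : ∀ (j : Fin n) (Q : Fin n →₀ ℕ), 1 ≤ Q.degree → (∀ m, mpow (μ m) Q = μ m j) →
    ∀ m, mpow (M m) Q = M m j

lemma NormalizedIntegration.transforms {ν : Fin ℓ → Fin n → ℂ} (h : NormalizedIntegration ν f Φ μ) :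
    TransformsToNormalForm ν f Φ := by
  refine ⟨fun i j => μ i j * X j, fun i => mul_X_fixesOrigin _, h.conjugacy, fun i m => ?_⟩
  funext j
  simp only [FormalMap.comp]
  have hd := (diagMap_fixesOrigin (ν m)).hasSubst
  have hx := (mul_X_fixesOrigin (μ i)).hasSubst
  rw [subst_mul hd, h.invariant, subst_X hd]
  conv_rhs => rw [FormalMap.diagMap]
  rw [subst_mul hx, subst_X hx, subst_C' (mul_X_fixesOrigin (μ i)), FormalMap.diagMap]
  ring

/-- A formal integration can be modified into a normalized one. -/
lemma exists_normalizedIntegration (h : IsFormalIntegration f Φ μ) {ν : Fin ℓ → Fin n → ℂ}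
    (hlin : ∀ i, (f i).linearPart = Matrix.diagonal (ν i)) (hν : ∀ i j, ν i j ≠ 0) :
    ∃ Ψ M, NormalizedIntegration ν f Ψ M := by
  classical
  obtain ⟨hΦ0, Φ', hΦ'0, hΦΦ', -⟩ := h.biholomorphism
  set ξ : Fin ℓ → Fin n → ℂ := fun m k => constantCoeff (μ m k) with hξ
  have hB : Φ.linearPart * Φ'.linearPart = 1 := by
    rw [← linearPart_comp hΦ'0, hΦΦ', linearPart_idMap]
  have hB' : Φ'.linearPart * Φ.linearPart = 1 := mul_eq_one_comm.1 hB
  -- The linear part of `Φ` intertwines the two diagonal families, so a nonzero entry `(j, k)`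
  -- identifies `ν_{ij}` with `ξ_{ik}` for all `i` at once.
  have hcomm : ∀ i j k, ν i j * Φ.linearPart j k = Φ.linearPart j k * ξ i k := by
    intro i j k
    have := congrArg FormalMap.linearPart (h.conjugacy i)
    rw [linearPart_comp hΦ0, linearPart_comp (mul_X_fixesOrigin _), hlin,
      linearPart_mul_X] at this
    simpa using congrFun (congrFun this j) k
  have hlinear_ne : ∀ {j k}, Φ.linearPart j k ≠ 0 → ∀ i, ν i j = ξ i k := fun {j k} hjk i =>
    mul_right_cancel₀ hjk (by rw [hcomm, mul_comm])
  have hrow : ∀ j, ∃ k, Φ.linearPart j k ≠ 0 := by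
    intro j
    by_contra hcon
    push Not at hcon
    have := congrFun (congrFun hB j) j
    simp [Matrix.mul_apply, hcon] at this
  have hcol : ∀ k, ∃ j, Φ.linearPart j k ≠ 0 := by
    intro k
    by_contra hcon
    push Not at hcon
    have := congrFun (congrFun hB' k) k
    simp [Matrix.mul_apply, hcon] at this
  -- `σ` need not be a permutation: only `ν_{ij} = ξ_{i,σ(j)}` matters.
  choose σ hσ' using hrow
  have hσ : ∀ i j, ν i j = ξ i (σ j) := fun i j => hlinear_ne (hσ' j) i
  have hξ0 : ∀ m k, constantCoeff (μ m k) ≠ 0 := by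
    intro m k
    obtain ⟨j, hj⟩ := hcol k
    change ξ m k ≠ 0
    rw [← hlinear_ne hj m]
    exact hν m j
  -- the part of `Φ` that intertwines the two diagonal families
  let c : FormalMap n := fun j P => if ∀ m, mpow (ξ m) P = ν m j then coeff P (Φ j) else 0
  have hcc : ∀ j P, coeff P (c j) = if ∀ m, mpow (ξ m) P = ν m j then coeff P (Φ j) else 0 :=
    fun j P => rfl
  have hc0 : c.FixesOrigin := fun j => by
    rw [← coeff_zero_eq_constantCoeff_apply, hcc, coeff_zero_eq_constantCoeff_apply,
      hΦ0 j, ite_self]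
  have hclin : c.linearPart = Φ.linearPart := by
    ext j k
    simp only [FormalMap.linearPart, Matrix.of_apply]
    rw [hcc]
    by_cases hjk : coeff (Finsupp.single k 1) (Φ j) = 0
    · rw [hjk, ite_self]
    · rw [if_pos]
      intro m
      rw [mpow_single_one]
      exact (hlinear_ne (j := j) (k := k) (by simpa [FormalMap.linearPart] using hjk) m).symm
  -- Each monomial `x^Q` of `c_j` has `ξ_m^Q = ξ_{m,σ(j)}` for all `m`, so `μ_m^Q = μ_{m,σ(j)}` as
  -- series and this factor comes out of the composition.
  have hcF : ∀ m, c.comp (fun j => μ m j * X j) = fun j => μ m (σ j) * c j := by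
    intro m
    funext j
    refine MvPowerSeries.ext fun P => ?_
    rw [FormalMap.comp, coeff_subst_mul_X, coeff_mul]
    refine Finset.sum_congr rfl fun x _ => ?_
    by_cases hx : coeff x.2 (c j) = 0
    · rw [hx, zero_mul, mul_zero]
    · have hr : ∀ m, mpow (ξ m) x.2 = ν m j := by
        by_contra hcon
        exact hx (by rw [hcc, if_neg hcon])
      have hdeg : 1 ≤ x.2.degree := by
        by_contra hlt
        exact hx (vanishBelow_one_iff.2 (hc0 j) _ (by omega))
      rw [h.mpow_eq hξ0 (j := σ j) hdeg (fun m => by rw [hr, hσ]) m, mul_comm]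
  have hcD : ∀ m, c.comp (FormalMap.diagMap (ξ m)) = (FormalMap.diagMap (ν m)).comp c := by
    intro m
    funext j
    refine MvPowerSeries.ext fun P => ?_
    rw [FormalMap.comp, FormalMap.comp, coeff_subst_diagMap, FormalMap.diagMap,
      subst_mul hc0.hasSubst, subst_X hc0.hasSubst, subst_C' hc0, coeff_C_mul, hcc]
    split_ifs with hr
    · rw [hr m]
    · rw [mul_zero, mul_zero]
  obtain ⟨e, he0, hce, hec⟩ := exists_formal_inverse hc0 (B := Φ'.linearPart) (by rw [hclin, hB])
  have heD : ∀ m, e.comp (FormalMap.diagMap (ν m)) = (FormalMap.diagMap (ξ m)).comp e := by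
    intro m
    have hd := diagMap_fixesOrigin (n := n) (ν m)
    have hd' := diagMap_fixesOrigin (n := n) (ξ m)
    calc e.comp (FormalMap.diagMap (ν m))
        = e.comp (((FormalMap.diagMap (ν m)).comp c).comp e) := by
          rw [comp_assoc hc0 he0, hce, comp_idMap]
      _ = (e.comp c).comp ((FormalMap.diagMap (ξ m)).comp e) := by
          rw [← hcD, comp_assoc hd' he0, comp_assoc hc0 (comp_fixesOrigin hd' he0)]
      _ = _ := by rw [hec, idMap_comp (comp_fixesOrigin hd' he0)]
  have hX : ∀ j, subst e (c j) = X j := fun j => congrFun hce j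
  -- With `e = c⁻¹`, the new normal form is `c ∘ F̂_m ∘ c⁻¹`, whose `j`-th component is `(μ_{m,σ(j)}
  -- ∘ e) x_j` because `c_j ∘ e = x_j`.
  refine ⟨Φ.comp e, fun m j => subst e (μ m (σ j)), ⟨comp_fixesOrigin hΦ0 he0, ?_, ?_⟩, ?_, ?_, ?_,
    ?_⟩
  · rw [linearPart_comp he0, ← hclin, ← linearPart_comp he0, hce, linearPart_idMap]
  · intro j Q hQ hr
    have hsplit : subst e (Φ j) = X j + subst e (Φ j - c j) := by
      rw [subst_sub he0.hasSubst, hX]; ring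
    rw [FormalMap.comp, hsplit, map_add, coeff_X, if_neg, zero_add,
      coeff_subst_eq_sum_box he0 _ le_rfl]
    · refine Finset.sum_eq_zero fun P _ => ?_
      by_contra hne
      have hne1 := left_ne_zero_of_mul hne
      have hne2 := right_ne_zero_of_mul hne
      have hnr : ¬ ∀ m, mpow (ξ m) P = ν m j := fun hr' => hne1 (by
        rw [map_sub, hcc, if_pos hr', sub_self])
      refine hnr fun m => ?_
      -- `e^P` is an eigenvector of composition with `diag(ν_m)`, with eigenvalue `ξ_m^P`. So a
      -- monomial `x^Q` in it has `ν_m^Q = ξ_m^P`, and the terms of `Φ - c` produce no resonant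
      -- `x^Q`.
      have hw : subst (FormalMap.diagMap (ν m)) (mpow e P) = C (mpow (ξ m) P) * mpow e P := by
        rw [subst_mpow (diagMap_fixesOrigin _), ← mpow_C, ← mpow_mul]
        congr 1
        funext k
        have := congrFun (heD m) k
        simp only [FormalMap.comp] at this
        rw [this, FormalMap.diagMap, subst_mul he0.hasSubst, subst_X he0.hasSubst, subst_C' he0]
      have hw' := congrArg (coeff Q) hw
      rw [coeff_subst_diagMap, coeff_C_mul] at hw'
      rw [← mul_right_cancel₀ hne2 hw']
      exact hr m
    · rintro rfl
      simp at hQ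
  · intro i
    have hF := mul_X_fixesOrigin (μ i)
    have hMX : FormalMap.FixesOrigin (fun j => subst e (μ i (σ j)) * X j) := mul_X_fixesOrigin _
    have hMX' : (fun j => subst e (μ i (σ j)) * X j)
        = (c.comp (fun j => μ i j * X j)).comp e := by
      rw [hcF]
      funext j
      rw [FormalMap.comp, subst_mul he0.hasSubst, hX]
    rw [← comp_assoc hΦ0 he0, h.conjugacy, comp_assoc hF he0, comp_assoc he0 hMX, hMX',
      comp_assoc hF he0, ← comp_assoc hc0 (comp_fixesOrigin hF he0), hec,
      idMap_comp (comp_fixesOrigin hF he0)]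
  · intro i j
    rw [constantCoeff_subst' he0, hσ]
  · intro i j m
    rw [subst_comp_subst_apply he0.hasSubst (diagMap_fixesOrigin _).hasSubst]
    have := heD m
    unfold FormalMap.comp at this
    rw [this, ← subst_comp_subst_apply (diagMap_fixesOrigin _).hasSubst he0.hasSubst]
    congr 1
    exact h.invariant i m (σ j)
  · intro j Q hQ hr m
    rw [← subst_mpow he0, mpow_comp]
    congr 1
    refine h.mpow_eq hξ0 (by rwa [Finsupp.degree_mapDomain]) (fun m => ?_) m
    rw [← mpow_comp]
    have := hr m
    rw [hσ, funext (hσ m)] at this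
    exact this

end Normalization

/-! ### Weighted `ℓ¹` norms of truncated series -/

section Norm

variable {n : ℕ}

/-- The weighted `ℓ¹` norm of the Taylor polynomial of degree `N`. -/
noncomputable def nrm (N : ℕ) (r : ℝ) (h : MvPowerSeries (Fin n) ℂ) : ℝ :=
  ∑ Q ∈ box n N, ‖coeff Q h‖ * r ^ Q.degree

variable {N : ℕ} {r : ℝ}

lemma nrm_nonneg (hr : 0 ≤ r) (h : MvPowerSeries (Fin n) ℂ) : 0 ≤ nrm N r h :=
  Finset.sum_nonneg fun _ _ => by positivity

lemma nrm_mono {N' : ℕ} (hr : 0 ≤ r) (hN : N ≤ N') (h : MvPowerSeries (Fin n) ℂ) :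
    nrm N r h ≤ nrm N' r h :=
  Finset.sum_le_sum_of_subset_of_nonneg (box_mono hN) fun _ _ _ => by positivity

lemma nrm_mono_radius {r' : ℝ} (hr : 0 ≤ r) (hrr : r ≤ r') (h : MvPowerSeries (Fin n) ℂ) :
    nrm N r h ≤ nrm N r' h := by
  unfold nrm
  gcongr

lemma nrm_add_le (hr : 0 ≤ r) (g h : MvPowerSeries (Fin n) ℂ) :
    nrm N r (g + h) ≤ nrm N r g + nrm N r h := by
  unfold nrm
  rw [← Finset.sum_add_distrib]
  refine Finset.sum_le_sum fun Q _ => ?_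
  rw [← add_mul, map_add]
  gcongr
  exact norm_add_le _ _

lemma nrm_sub_le (hr : 0 ≤ r) (g h : MvPowerSeries (Fin n) ℂ) :
    nrm N r (g - h) ≤ nrm N r g + nrm N r h := by
  unfold nrm
  rw [← Finset.sum_add_distrib]
  refine Finset.sum_le_sum fun Q _ => ?_
  rw [← add_mul, map_sub]
  gcongr
  exact norm_sub_le _ _

lemma nrm_C_mul (a : ℂ) (h : MvPowerSeries (Fin n) ℂ) : nrm N r (C a * h) = ‖a‖ * nrm N r h := by
  simp only [nrm, coeff_C_mul, norm_mul, Finset.mul_sum, mul_assoc]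

lemma nrm_C (a : ℂ) : nrm N r (C a : MvPowerSeries (Fin n) ℂ) = ‖a‖ := by
  classical
  rw [nrm, Finset.sum_eq_single 0]
  · simp
  · intro Q _ hQ
    rw [coeff_C, if_neg hQ]; simp
  · intro h; simp at h

lemma nrm_one : nrm N r (1 : MvPowerSeries (Fin n) ℂ) = 1 := by
  rw [← map_one C, nrm_C, norm_one]

lemma nrm_X_le (hr : 0 ≤ r) (k : Fin n) : nrm N r (X k : MvPowerSeries (Fin n) ℂ) ≤ r := by
  classical
  refine (nrm_mono hr (Nat.le_succ N) _).trans ?_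
  rw [nrm, Finset.sum_eq_single (Finsupp.single k 1)]
  · simp
  · intro Q _ hQ
    rw [coeff_X, if_neg hQ]; simp
  · intro h; simp at h

lemma sum_box_antidiagonal (F : (Fin n →₀ ℕ) → (Fin n →₀ ℕ) → ℝ) :
    ∑ P ∈ box n N, ∑ x ∈ Finset.HasAntidiagonal.antidiagonal P, F x.1 x.2
      = ∑ Q ∈ box n N, ∑ R ∈ box n (N - Q.degree), F R Q := by
  rw [Finset.sum_sigma', Finset.sum_sigma']
  refine Finset.sum_bij' (fun y _ => ⟨y.2.2, y.2.1⟩) (fun y _ => ⟨y.2 + y.1, (y.2, y.1)⟩)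
    ?_ ?_ ?_ ?_ ?_
  · rintro ⟨P, x⟩ hx
    simp only [Finset.mem_sigma, mem_box] at hx ⊢
    have := degree_add_of_mem_antidiagonal hx.2
    omega
  · rintro ⟨Q, R⟩ hx
    simp only [Finset.mem_sigma, mem_box, Finset.HasAntidiagonal.mem_antidiagonal, map_add,
      and_true] at hx ⊢
    omega
  · rintro ⟨P, x⟩ hx
    simp only [Finset.mem_sigma, Finset.HasAntidiagonal.mem_antidiagonal] at hx
    simp [← hx.2]
  · rintro ⟨Q, R⟩ _; rfl
  · rintro ⟨P, x⟩ _; rfl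

/-- The estimate behind the submultiplicativity of the norm; the first factor may depend on the
exponent of the second. -/
lemma sum_box_antidiagonal_le (hr : 0 ≤ r) {a : (Fin n →₀ ℕ) → (Fin n →₀ ℕ) → ℝ}
    {b : (Fin n →₀ ℕ) → ℝ} {K : ℝ} (hb : ∀ Q, 0 ≤ b Q)
    (hK : ∀ Q ∈ box n N, b Q ≠ 0 → ∑ R ∈ box n (N - Q.degree), a R Q * r ^ R.degree ≤ K) :
    ∑ P ∈ box n N, (∑ x ∈ Finset.HasAntidiagonal.antidiagonal P, a x.1 x.2 * b x.2) * r ^ P.degree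
      ≤ K * ∑ Q ∈ box n N, b Q * r ^ Q.degree := by
  have h1 : ∀ P ∈ box n N,
      (∑ x ∈ Finset.HasAntidiagonal.antidiagonal P, a x.1 x.2 * b x.2) * r ^ P.degree
      = ∑ x ∈ Finset.HasAntidiagonal.antidiagonal P,
          a x.1 x.2 * r ^ x.1.degree * (b x.2 * r ^ x.2.degree) := by
    intro P _
    rw [Finset.sum_mul]
    refine Finset.sum_congr rfl fun x hx => ?_
    rw [← degree_add_of_mem_antidiagonal hx, pow_add]
    ring
  rw [Finset.sum_congr rfl h1,
    sum_box_antidiagonal fun R Q => a R Q * r ^ R.degree * (b Q * r ^ Q.degree), Finset.mul_sum]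
  refine Finset.sum_le_sum fun Q hQ => ?_
  rw [← Finset.sum_mul]
  by_cases h0 : b Q = 0
  · simp [h0]
  · have := hb Q
    exact mul_le_mul_of_nonneg_right (hK Q hQ h0) (by positivity)

/-- A coefficient of degree at most `N` in a product involves only coefficients of degree at most
`N` in the factors. Truncation thus preserves the Banach algebra inequality, and no convergence is
presupposed. -/
lemma nrm_mul_le (hr : 0 ≤ r) (g h : MvPowerSeries (Fin n) ℂ) :
    nrm N r (g * h) ≤ nrm N r g * nrm N r h := by
  classical
  refine le_trans ?_ (sum_box_antidiagonal_le (a := fun R _ => ‖coeff R g‖) hr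
    (fun Q => norm_nonneg (coeff Q h)) fun Q _ _ => nrm_mono hr (Nat.sub_le N Q.degree) g)
  refine Finset.sum_le_sum fun P _ => ?_
  gcongr
  rw [coeff_mul]
  refine (norm_sum_le _ _).trans (le_of_eq ?_)
  simp

lemma nrm_mpow_le (hr : 0 ≤ r) {ρ : ℝ} {g : FormalMap n} (hg : ∀ k, nrm N r (g k) ≤ ρ)
    (Q : Fin n →₀ ℕ) : nrm N r (mpow g Q) ≤ ρ ^ Q.degree := by
  have step : ∀ P Q : Fin n →₀ ℕ, nrm N r (mpow g P) ≤ ρ ^ P.degree →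
      nrm N r (mpow g Q) ≤ ρ ^ Q.degree → nrm N r (mpow g (P + Q)) ≤ ρ ^ (P + Q).degree := by
    intro P Q hP hQ
    rw [mpow_add, map_add, pow_add]
    refine (nrm_mul_le hr _ _).trans ?_
    exact mul_le_mul hP hQ (nrm_nonneg hr _) ((nrm_nonneg hr _).trans hP)
  induction Q using Finsupp.induction_linear with
  | zero => simp [nrm_one]
  | add P Q hP hQ => exact step P Q hP hQ
  | single k m =>
    induction m with
    | zero => simp [nrm_one]
    | succ m ih =>
      rw [Finsupp.single_add]
      refine step _ _ ih ?_
      simpa [mpow_single_one] using hg k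

lemma nrm_sum_le {ι : Type*} (hr : 0 ≤ r) (s : Finset ι) (g : ι → MvPowerSeries (Fin n) ℂ) :
    nrm N r (∑ i ∈ s, g i) ≤ ∑ i ∈ s, nrm N r (g i) := by
  classical
  induction s using Finset.induction_on with
  | empty => simp [nrm]
  | insert i s hi ih =>
    rw [Finset.sum_insert hi, Finset.sum_insert hi]
    exact (nrm_add_le hr _ _).trans (by gcongr)

lemma nrm_congr {g h : MvPowerSeries (Fin n) ℂ}
    (hgh : ∀ Q : Fin n →₀ ℕ, Q.degree ≤ N → coeff Q g = coeff Q h) : nrm N r g = nrm N r h :=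
  Finset.sum_congr rfl fun Q hQ => by rw [hgh Q (mem_box.1 hQ)]

lemma nrm_subst_le (hr : 0 ≤ r) {ρ : ℝ} {g : FormalMap n} (hg0 : g.FixesOrigin)
    (hg : ∀ k, nrm N r (g k) ≤ ρ) (f : MvPowerSeries (Fin n) ℂ) :
    nrm N r (subst g f) ≤ nrm N ρ f := by
  have : nrm N r (subst g f) = nrm N r (∑ Q ∈ box n N, C (coeff Q f) * mpow g Q) :=
    nrm_congr fun P hP => by
      rw [coeff_subst_eq_sum_box hg0 f hP, map_sum]
      simp only [coeff_C_mul]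
  rw [this]
  refine (nrm_sum_le hr _ _).trans ?_
  refine Finset.sum_le_sum fun Q _ => ?_
  rw [nrm_C_mul]
  gcongr
  exact nrm_mpow_le hr hg Q

/-- A Schwarz lemma: reducing the radius from `ρ` to `r` shrinks every surviving monomial by at
least `(r / ρ)^d`. -/
lemma nrm_le_of_vanishBelow {ρ : ℝ} (hr : 0 ≤ r) (hρ : 0 < ρ) (hrρ : r ≤ ρ) {d : ℕ}
    {h : MvPowerSeries (Fin n) ℂ} (hh : VanishBelow d h) :
    nrm N r h ≤ (r / ρ) ^ d * nrm N ρ h := by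
  unfold nrm
  rw [Finset.mul_sum]
  refine Finset.sum_le_sum fun Q _ => ?_
  by_cases hQ : Q.degree < d
  · rw [hh Q hQ]; simp
  · have h1 : (r / ρ) ^ Q.degree ≤ (r / ρ) ^ d :=
      pow_le_pow_of_le_one (by positivity) ((div_le_one hρ).2 hrρ) (by omega)
    calc ‖coeff Q h‖ * r ^ Q.degree
        = ‖coeff Q h‖ * ((r / ρ) ^ Q.degree * ρ ^ Q.degree) := by
          rw [← mul_pow, div_mul_cancel₀ _ hρ.ne']
      _ ≤ ‖coeff Q h‖ * ((r / ρ) ^ d * ρ ^ Q.degree) := by gcongr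
      _ = _ := by ring

/-- For `K = (V - b)⁻¹` one has `(v - b) K = 1 - (V - v) K`. The last term is at most `δ / 2` times
the norm of `K`, which is finite by truncation and can be absorbed on the left. -/
lemma nrm_inv_sub_le (hr : 0 ≤ r) {V : MvPowerSeries (Fin n) ℂ} {v b : ℂ} {δ : ℝ} (hδ : 0 < δ)
    (hv : constantCoeff V = v) (hvb : δ ≤ ‖v - b‖) (hV : nrm N r (V - C v) ≤ δ / 2) :
    nrm N r (V - C b)⁻¹ ≤ 2 / δ := by
  set K := (V - C b)⁻¹ with hK
  have hne : constantCoeff (V - C b) ≠ 0 := by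
    rw [map_sub, hv, constantCoeff_C]
    intro h0
    rw [h0, norm_zero] at hvb
    linarith
  have h1 : C (v - b) * K = 1 - (V - C v) * K := by
    have : (V - C b) * K = 1 := MvPowerSeries.mul_inv_cancel _ hne
    rw [map_sub]
    linear_combination this
  have h2 : ‖v - b‖ * nrm N r K ≤ 1 + δ / 2 * nrm N r K := by
    rw [← nrm_C_mul, h1]
    refine (nrm_sub_le hr _ _).trans ?_
    rw [nrm_one]
    gcongr
    refine (nrm_mul_le hr _ _).trans ?_
    have := nrm_nonneg (N := N) hr K
    gcongr
  have h3 : δ * nrm N r K ≤ ‖v - b‖ * nrm N r K := by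
    have := nrm_nonneg (N := N) hr K
    gcongr
  rw [le_div_iff₀ hδ]
  linarith

lemma nrm_mpow_sub_one_le (hr : 0 ≤ r) {u : Fin n → MvPowerSeries (Fin n) ℂ} {x : ℝ}
    (hu : ∀ k, nrm N r (u k - 1) ≤ x) (Q : Fin n →₀ ℕ) :
    nrm N r (mpow u Q - 1) ≤ (1 + x) ^ Q.degree - 1 := by
  have step : ∀ P Q : Fin n →₀ ℕ, nrm N r (mpow u P - 1) ≤ (1 + x) ^ P.degree - 1 →
      nrm N r (mpow u Q - 1) ≤ (1 + x) ^ Q.degree - 1 →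
      nrm N r (mpow u (P + Q) - 1) ≤ (1 + x) ^ (P + Q).degree - 1 := by
    intro P Q hP hQ
    have e : mpow u (P + Q) - 1
        = (mpow u P - 1) * (mpow u Q - 1) + (mpow u P - 1) + (mpow u Q - 1) := by
      rw [mpow_add]; ring
    rw [e, map_add, pow_add]
    have h1 := nrm_add_le (N := N) hr ((mpow u P - 1) * (mpow u Q - 1) + (mpow u P - 1))
      (mpow u Q - 1)
    have h2 := nrm_add_le (N := N) hr ((mpow u P - 1) * (mpow u Q - 1)) (mpow u P - 1)
    have h3 := nrm_mul_le (N := N) hr (mpow u P - 1) (mpow u Q - 1)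
    have h4 := mul_le_mul hP hQ (nrm_nonneg hr _) ((nrm_nonneg hr _).trans hP)
    linarith
  induction Q using Finsupp.induction_linear with
  | zero => simp [nrm]
  | add P Q hP hQ => exact step P Q hP hQ
  | single k m =>
    induction m with
    | zero => simp [nrm]
    | succ m ih =>
      rw [Finsupp.single_add]
      refine step _ _ ih ?_
      simpa [mpow_single_one] using hu k

lemma nrm_inv_sub_one_le (hr : 0 ≤ r) {u : MvPowerSeries (Fin n) ℂ} (hu0 : constantCoeff u = 1)
    {ε : ℝ} (hε : ε ≤ 1 / 2) (hu : nrm N r (u - 1) ≤ ε) : nrm N r (u⁻¹ - 1) ≤ 2 * ε := by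
  have h1 : nrm N r u⁻¹ ≤ 2 := by
    have := nrm_inv_sub_le (N := N) (b := 0) hr one_pos hu0 (by simp)
      (by rw [map_one]; linarith)
    simpa using this
  have h2 : u⁻¹ - 1 = -(C 1 * ((u - 1) * u⁻¹)) := by
    have : u * u⁻¹ = 1 := MvPowerSeries.mul_inv_cancel _ (by rw [hu0]; exact one_ne_zero)
    rw [map_one]
    linear_combination this
  have h3 : nrm N r (u⁻¹ - 1) = nrm N r ((u - 1) * u⁻¹) := by
    rw [h2, ← neg_mul, ← map_neg, nrm_C_mul]; simp
  rw [h3]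
  refine (nrm_mul_le hr _ _).trans ?_
  rw [mul_comm 2]
  exact mul_le_mul hu h1 (nrm_nonneg hr _) ((nrm_nonneg hr _).trans hu)

end Norm

/-! ### Uniform bounds for the inverse divisors -/

section SmallDivisors

variable {n : ℕ}

/-- The slope `((1 + y)^q - 1) / y` is a geometric sum, hence monotone in `y`. -/
lemma one_add_pow_sub_one_le {x s : ℝ} (hx : 0 ≤ x) (hxs : x ≤ s) (hs : 0 < s) (q : ℕ) :
    (1 + x) ^ q - 1 ≤ x / s * (1 + s) ^ q := by
  have h1 : ∀ y : ℝ, (1 + y) ^ q - 1 = (∑ k ∈ Finset.range q, (1 + y) ^ k) * y := fun y => by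
    rw [← geom_sum_mul (1 + y) q]; ring
  calc (1 + x) ^ q - 1 = (∑ k ∈ Finset.range q, (1 + x) ^ k) * x := h1 x
    _ ≤ (∑ k ∈ Finset.range q, (1 + s) ^ k) * x := by gcongr
    _ = x / s * ((∑ k ∈ Finset.range q, (1 + s) ^ k) * s) := by field_simp
    _ = x / s * ((1 + s) ^ q - 1) := by rw [h1 s]
    _ ≤ x / s * (1 + s) ^ q := by gcongr; linarith

/-- The values concerned decay like `d^(-|Q|)`, so all but finitely many stay at distance `‖b‖ / 2`
from `b`; the remaining ones are finite in number. -/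
lemma exists_gap (w : (Fin n →₀ ℕ) → ℂ) {b : ℂ} (hb : b ≠ 0) {d : ℝ} (c : ℝ) (hd : 1 < d) :
    ∃ δ > 0, ∀ Q : Fin n →₀ ℕ, ‖w Q‖ * d ^ Q.degree ≤ c → w Q ≠ b → δ ≤ ‖w Q - b‖ := by
  classical
  have hb' : 0 < ‖b‖ := norm_pos_iff.2 hb
  obtain ⟨N, hN⟩ := pow_unbounded_of_one_lt (c / (‖b‖ / 2)) hd
  have hfar : ∀ Q : Fin n →₀ ℕ, N ≤ Q.degree → ‖w Q‖ * d ^ Q.degree ≤ c →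
      ‖b‖ / 2 ≤ ‖w Q - b‖ := by
    intro Q hQ hw
    have h1 : c / (‖b‖ / 2) < d ^ Q.degree := hN.trans_le (pow_le_pow_right₀ hd.le hQ)
    rw [div_lt_iff₀ (by positivity)] at h1
    have hpos : 0 < d ^ Q.degree := by positivity
    have h2 : ‖w Q‖ ≤ ‖b‖ / 2 := by
      by_contra hlt
      push Not at hlt
      nlinarith
    have h3 := norm_sub_norm_le b (w Q)
    rw [norm_sub_rev] at h3
    linarith
  rcases ((box n N).filter fun Q => w Q ≠ b).eq_empty_or_nonempty with he | hne
  · refine ⟨‖b‖ / 2, by positivity, fun Q hw hQ => hfar Q ?_ hw⟩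
    by_contra hlt
    have : Q ∈ (box n N).filter fun Q => w Q ≠ b := by
      rw [Finset.mem_filter, mem_box]; exact ⟨by omega, hQ⟩
    rw [he] at this
    simp at this
  · obtain ⟨Q₀, hQ₀, hmin⟩ := Finset.exists_min_image _ (fun Q => ‖w Q - b‖) hne
    refine ⟨min (‖b‖ / 2) ‖w Q₀ - b‖, lt_min (by positivity)
      (norm_pos_iff.2 (sub_ne_zero.2 (Finset.mem_filter.1 hQ₀).2)), fun Q hw hQ => ?_⟩
    by_cases hlt : N ≤ Q.degree
    · exact (min_le_left _ _).trans (hfar Q hlt hw)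
    · refine (min_le_right _ _).trans (hmin Q ?_)
      rw [Finset.mem_filter, mem_box]; exact ⟨by omega, hQ⟩

/-- The growth of `u^Q` with `|Q|` is absorbed by the decay of `v`, so the bound does not depend on
`Q`. -/
lemma nrm_C_mul_mpow_sub_le {N : ℕ} {r : ℝ} (hr : 0 ≤ r) {u : Fin n → MvPowerSeries (Fin n) ℂ}
    {x d c : ℝ} (hx : 0 ≤ x) (hd : 1 < d) (hxd : x ≤ d - 1)
    (hu : ∀ k, nrm N r (u k - 1) ≤ x) {v : ℂ} {Q : Fin n →₀ ℕ} (hv : ‖v‖ * d ^ Q.degree ≤ c) :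
    nrm N r (C v * mpow u Q - C v) ≤ c * (x / (d - 1)) := by
  have e : C v * mpow u Q - C v = C v * (mpow u Q - 1) := by ring
  have hd' : 0 < d - 1 := by linarith
  rw [e, nrm_C_mul]
  calc ‖v‖ * nrm N r (mpow u Q - 1) ≤ ‖v‖ * ((1 + x) ^ Q.degree - 1) := by
        gcongr; exact nrm_mpow_sub_one_le hr hu Q
    _ ≤ ‖v‖ * (x / (d - 1) * (1 + (d - 1)) ^ Q.degree) := by
        gcongr; exact one_add_pow_sub_one_le hx hxd hd' _
    _ = ‖v‖ * d ^ Q.degree * (x / (d - 1)) := by rw [add_sub_cancel]; ring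
    _ ≤ _ := by gcongr

/-- The divisors of the homological equation are bounded away from zero, uniformly under small
perturbations of the eigenvalues. -/
lemma exists_nrm_inv_le {a : Fin n → ℂ} (ha : ∀ k, a k ≠ 0) {b : ℂ} (hb : b ≠ 0) {d c : ℝ}
    (hd : 1 < d) (hc : 0 < c) :
    ∃ K > 0, ∃ ε > 0, ∀ (N : ℕ) (r : ℝ), 0 ≤ r → ∀ u : Fin n → MvPowerSeries (Fin n) ℂ,
      (∀ k, constantCoeff (u k) = 1) → (∀ k, nrm N r (u k - 1) ≤ ε) →
      ∀ Q : Fin n →₀ ℕ, mpow a Q ≠ b →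
        c⁻¹ * d ^ Q.degree < max ‖mpow a Q‖ ‖(mpow a Q)⁻¹‖ →
        nrm N r (C (mpow a Q) * mpow u Q - C b)⁻¹ ≤ K := by
  obtain ⟨δ₁, hδ₁, h₁⟩ := exists_gap (fun Q => mpow a Q) hb c hd
  obtain ⟨δ₂, hδ₂, h₂⟩ := exists_gap (fun Q => (mpow a Q)⁻¹) (inv_ne_zero hb) c hd
  have hs : 0 < d - 1 := by linarith
  -- The last two terms keep the perturbations below half of the gaps, `d - 1` allows the slope
  -- estimate, and `1` makes `x / 2` small enough for inverting `u_k`. The tolerance is `x / 2`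
  -- because inversion may double the deviation from `1`.
  set x : ℝ := min 1 (min (d - 1) (min (δ₁ * (d - 1) / (2 * c)) (δ₂ * (d - 1) / (2 * c)))) with hx
  have hx0 : 0 < x := by positivity
  have hx1 : x ≤ 1 := min_le_left _ _
  have hxd : x ≤ d - 1 := (min_le_right _ _).trans (min_le_left _ _)
  have hxδ₁ : c * (x / (d - 1)) ≤ δ₁ / 2 := by
    have : x ≤ δ₁ * (d - 1) / (2 * c) :=
      (min_le_right _ _).trans ((min_le_right _ _).trans (min_le_left _ _))
    rw [le_div_iff₀ (by positivity)] at this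
    rw [← mul_div_assoc, div_le_iff₀ hs]
    linarith
  have hxδ₂ : c * (x / (d - 1)) ≤ δ₂ / 2 := by
    have : x ≤ δ₂ * (d - 1) / (2 * c) :=
      (min_le_right _ _).trans ((min_le_right _ _).trans (min_le_right _ _))
    rw [le_div_iff₀ (by positivity)] at this
    rw [← mul_div_assoc, div_le_iff₀ hs]
    linarith
  refine ⟨max (2 / δ₁) (‖b⁻¹‖ * ((c + δ₂ / 2) * (2 / δ₂))), lt_max_of_lt_left (by positivity),
    x / 2, by positivity, ?_⟩
  intro N r hr u hu0 hu Q hQ hmax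
  have hcst : ∀ (a : ℂ) (u : Fin n → MvPowerSeries (Fin n) ℂ), (∀ k, constantCoeff (u k) = 1) →
      constantCoeff (C a * mpow u Q) = a := by
    intro a u hu
    rw [map_mul, constantCoeff_C, constantCoeff_mpow, funext hu, mpow_const, one_pow, mul_one]
  rcases lt_max_iff.1 hmax with hA | hB
  · -- the divisor is large
    refine le_trans ?_ (le_max_right _ _)
    have hv : ‖(mpow a Q)⁻¹‖ * d ^ Q.degree ≤ c := by
      rw [norm_inv, inv_mul_le_iff₀ (norm_pos_iff.2 (mpow_ne_zero ha Q))]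
      rw [inv_mul_lt_iff₀ hc] at hA
      linarith
    have hu' : ∀ k, nrm N r ((u k)⁻¹ - 1) ≤ x := fun k => by
      have := nrm_inv_sub_one_le hr (hu0 k) (by linarith) (hu k)
      linarith
    have hu0' : ∀ k, constantCoeff (u k)⁻¹ = 1 := fun k => by
      rw [constantCoeff_inv, hu0, inv_one]
    set V := C (mpow a Q)⁻¹ * mpow (fun k => (u k)⁻¹) Q with hV
    have hVn : nrm N r (V - C (mpow a Q)⁻¹) ≤ δ₂ / 2 :=
      (nrm_C_mul_mpow_sub_le hr hx0.le hd hxd hu' hv).trans hxδ₂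
    have hgap : δ₂ ≤ ‖(mpow a Q)⁻¹ - b⁻¹‖ := h₂ Q hv fun h => hQ (inv_injective h)
    have hinv := nrm_inv_sub_le hr hδ₂ (hcst _ _ hu0') hgap hVn
    have hVW : (C (mpow a Q) * mpow u Q) * V = 1 := by
      have e1 : mpow u Q * mpow (fun k => (u k)⁻¹) Q = 1 := by
        rw [← mpow_mul]
        have : ∀ k, u k * (u k)⁻¹ = 1 := fun k =>
          MvPowerSeries.mul_inv_cancel _ (by rw [hu0]; exact one_ne_zero)
        simp only [this, mpow_const, one_pow]
      calc _ = (C (mpow a Q) * C (mpow a Q)⁻¹) * (mpow u Q * mpow (fun k => (u k)⁻¹) Q) := by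
            rw [hV]; ring
        _ = 1 := by rw [e1, ← map_mul, mul_inv_cancel₀ (mpow_ne_zero ha Q), map_one, mul_one]
    have hbb : (C b : MvPowerSeries (Fin n) ℂ) * C b⁻¹ = 1 := by
      rw [← map_mul, mul_inv_cancel₀ hb, map_one]
    have hVb : (V - C b⁻¹) * (V - C b⁻¹)⁻¹ = 1 := by
      refine MvPowerSeries.mul_inv_cancel _ ?_
      rw [map_sub, hcst _ _ hu0', constantCoeff_C, sub_ne_zero]
      exact fun h => hQ (inv_injective h)
    -- With `W = V⁻¹`, the identity `(W - b)⁻¹ = -b⁻¹ V (V - b⁻¹)⁻¹` reduces a large divisor to the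
    -- small series `V`.
    have hKeq : (C (mpow a Q) * mpow u Q - C b)⁻¹ = C (-b⁻¹) * (V * (V - C b⁻¹)⁻¹) := by
      rw [MvPowerSeries.inv_eq_iff_mul_eq_one, map_neg]
      · linear_combination -C b⁻¹ * (V - C b⁻¹)⁻¹ * hVW + V * (V - C b⁻¹)⁻¹ * hbb + hVb
      · rw [map_sub, hcst _ _ hu0, constantCoeff_C, sub_ne_zero]
        exact hQ
    rw [hKeq, nrm_C_mul, norm_neg]
    have hVle : nrm N r V ≤ c + δ₂ / 2 := by
      have e : V = C (mpow a Q)⁻¹ + (V - C (mpow a Q)⁻¹) := by ring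
      rw [e]
      refine (nrm_add_le hr _ _).trans (add_le_add ?_ hVn)
      rw [nrm_C]
      have : 1 ≤ d ^ Q.degree := one_le_pow₀ hd.le
      nlinarith [norm_nonneg (mpow a Q)⁻¹]
    gcongr
    refine (nrm_mul_le hr _ _).trans ?_
    exact mul_le_mul hVle hinv (nrm_nonneg hr _) (by positivity)
  · -- the divisor is small
    refine le_trans ?_ (le_max_left _ _)
    have hv : ‖mpow a Q‖ * d ^ Q.degree ≤ c := by
      rw [norm_inv, lt_inv_comm₀ (by positivity) (norm_pos_iff.2 (mpow_ne_zero ha Q)), mul_inv,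
        inv_inv, ← div_eq_mul_inv, lt_div_iff₀ (by positivity)] at hB
      exact hB.le
    exact nrm_inv_sub_le hr hδ₁ (hcst _ _ hu0) (h₁ Q hv hQ)
      ((nrm_C_mul_mpow_sub_le hr hx0.le hd hxd (fun k => (hu k).trans (by linarith)) hv).trans
        hxδ₁)

end SmallDivisors

/-! ### The homological equation and the convergence of the normalization -/

section Convergence

variable {n ℓ : ℕ}

/-- The power series converges absolutely on a polydisc around the origin. -/
def Converges (h : MvPowerSeries (Fin n) ℂ) : Prop :=
  ∃ ρ > 0, ∃ B, ∀ N, nrm N ρ h ≤ B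

variable {f : Fin ℓ → FormalMap n} {Φ : FormalMap n} {μ : Fin ℓ → Fin n → ℂ}
  {M : Fin ℓ → Fin n → MvPowerSeries (Fin n) ℂ}

lemma NormalizedIntegration.mpow_eq_one (h : NormalizedIntegration μ f Φ M)
    (hμ : ∀ i j, μ i j ≠ 0) {R : Fin n →₀ ℕ} (hR : ∀ m, mpow (μ m) R = 1) (m : Fin ℓ) :
    mpow (M m) R = 1 := by
  have e : ∀ m, (fun k => constantCoeff (M m k)) = μ m := fun m => funext (h.constantCoeff_eq m)
  refine mpow_eq_one_of_resonant (fun m k => by rw [h.constantCoeff_eq]; exact hμ m k)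
    (fun j Q hQ hr => h.resonant j Q hQ.le fun m => ?_) (fun m => by rw [e]; exact hR m) m
  rw [← e m]
  exact hr m

/-- Products of invariant series are invariant. Together with `NormalizedIntegration.mpow_eq_one`,
multiplying by monomials of `M_i^Q` leaves the class of an exponent unchanged. -/
lemma NormalizedIntegration.mpow_eq_one_of_coeff (h : NormalizedIntegration μ f Φ M) {i : Fin ℓ}
    {Q R : Fin n →₀ ℕ} (hR : coeff R (mpow (M i) Q) ≠ 0) (m : Fin ℓ) : mpow (μ m) R = 1 := by
  refine mpow_eq_one_of_coeff_ne_zero (fun m => ?_) hR m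
  rw [subst_mpow (diagMap_fixesOrigin _)]
  congr 1
  exact funext fun k => h.invariant i k m

/-- The nonlinear part of `f_i ∘ Φ`. -/
noncomputable def remainder (μ : Fin ℓ → Fin n → ℂ) (f : Fin ℓ → FormalMap n) (Φ : FormalMap n)
    (i : Fin ℓ) (j : Fin n) : MvPowerSeries (Fin n) ℂ :=
  subst Φ (f i j) - C (μ i j) * Φ j

lemma NormalizedIntegration.coeff_subst_eq (h : NormalizedIntegration μ f Φ M) (i : Fin ℓ)
    (j : Fin n) (P : Fin n →₀ ℕ) :
    coeff P (subst Φ (f i j))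
      = ∑ x ∈ Finset.HasAntidiagonal.antidiagonal P,
          coeff x.2 (Φ j) * coeff x.1 (mpow (M i) x.2) := by
  rw [show subst Φ (f i j) = subst (fun k => M i k * X k) (Φ j) from congrFun (h.conjugacy i) j,
    coeff_subst_mul_X]

/-- The normal form is controlled by the resonant terms of the remainder. -/
lemma NormalizedIntegration.norm_coeff_le (h : NormalizedIntegration μ f Φ M) (i : Fin ℓ)
    (j : Fin n) {R : Fin n →₀ ℕ} (hR : R ≠ 0) :
    ‖coeff R (M i j)‖ ≤ ‖coeff (R + Finsupp.single j 1) (remainder μ f Φ i j)‖ := by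
  classical
  by_cases h0 : coeff R (M i j) = 0
  · rw [h0, norm_zero]; exact norm_nonneg _
  have hR1 : ∀ m, mpow (μ m) R = 1 := by
    rw [← mpow_single_one (M i) j] at h0
    exact h.mpow_eq_one_of_coeff h0
  have hdeg : R.degree ≠ 0 := by rwa [ne_eq, Finsupp.degree_eq_zero_iff]
  have hP : ∀ m, mpow (μ m) (R + Finsupp.single j 1) = μ m j := fun m => by
    rw [mpow_add, hR1, mpow_single_one, one_mul]
  have hlin : ∀ k, coeff (Finsupp.single k 1) (Φ j) = (1 : Matrix (Fin n) (Fin n) ℂ) j k :=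
    fun k => congrFun (congrFun h.normalized.2.1 j) k
  refine le_of_eq (congrArg _ ?_)
  rw [remainder, map_sub, coeff_C_mul, h.normalized.2.2 j (R + Finsupp.single j 1)
    (by rw [map_add, Finsupp.degree_single]; omega) hP, mul_zero, sub_zero, h.coeff_subst_eq,
    Finset.sum_eq_single (R, Finsupp.single j 1)]
  · simp only [mpow_single_one, hlin]
    rw [Matrix.one_apply_eq, one_mul]
  -- Any other contributing `Q` would be resonant, because `S` has weight `1`, and the only resonant
  -- term of the normalized `Φ_j` is `x_j`.
  · rintro ⟨S, Q⟩ hx hne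
    rw [Finset.HasAntidiagonal.mem_antidiagonal] at hx
    dsimp only at hx ⊢
    by_contra hcon
    have hQ := left_ne_zero_of_mul hcon
    have hS := h.mpow_eq_one_of_coeff (right_ne_zero_of_mul hcon)
    have hQres : ∀ m, mpow (μ m) Q = μ m j := fun m => by
      rw [← hP m, ← hx, mpow_add, hS, one_mul]
    rcases Nat.lt_or_ge Q.degree 2 with h2 | h2
    · rcases Nat.lt_or_ge Q.degree 1 with h1 | h1
      · exact hQ (vanishBelow_one_iff.2 (h.normalized.1 j) Q h1)
      · obtain ⟨k, rfl⟩ := degree_eq_one (by omega : Q.degree = 1)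
        rw [hlin] at hQ
        have hjk : j = k := by
          by_contra hjk
          exact hQ (Matrix.one_apply_ne hjk)
        subst hjk
        exact hne (by rw [add_right_cancel hx])
    · exact hQ (h.normalized.2.2 j Q h2 hQres)
  · intro hx
    exact (hx (by rw [Finset.HasAntidiagonal.mem_antidiagonal])).elim

/-- The homological equation for the nonresonant terms of `Φ`: in the class of the exponent `P`, it
is solved by division by the power series `M_i^P - μ_{ij}`. -/
lemma NormalizedIntegration.coeff_eq_sum (h : NormalizedIntegration μ f Φ M)
    (hμ : ∀ i j, μ i j ≠ 0) {i : Fin ℓ} {j : Fin n} {P : Fin n →₀ ℕ}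
    (hP : mpow (μ i) P ≠ μ i j) [DecidableEq (Fin ℓ → MvPowerSeries (Fin n) ℂ)] :
    coeff P (Φ j) = ∑ x ∈ Finset.HasAntidiagonal.antidiagonal P,
      coeff x.1 (mpow (M i) P - C (μ i j))⁻¹ *
        if (fun m => mpow (M m) x.2) = (fun m => mpow (M m) P)
          then coeff x.2 (remainder μ f Φ i j) else 0 := by
  classical
  -- The projection onto the monomials in the class of `P`.
  let restr : MvPowerSeries (Fin n) ℂ → MvPowerSeries (Fin n) ℂ := fun g Q =>
    if (fun m => mpow (M m) Q) = (fun m => mpow (M m) P) then coeff Q g else 0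
  have hrestr : ∀ g Q, coeff Q (restr g)
      = if (fun m => mpow (M m) Q) = (fun m => mpow (M m) P) then coeff Q g else 0 :=
    fun g Q => rfl
  have hshift : ∀ {S Q Q' : Fin n →₀ ℕ}, coeff S (mpow (M i) Q') ≠ 0 → ∀ m,
      mpow (M m) (S + Q) = mpow (M m) Q := fun {S Q Q'} hS m => by
    rw [mpow_add, h.mpow_eq_one hμ (h.mpow_eq_one_of_coeff hS), one_mul]
  have hne : constantCoeff (mpow (M i) P - C (μ i j)) ≠ 0 := by
    rw [map_sub, constantCoeff_mpow, funext (h.constantCoeff_eq i), constantCoeff_C, sub_ne_zero]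
    exact hP
  -- Within the class, composition with the normal form is multiplication by one series, as `M_i^Q =
  -- M_i^P` there.
  have hmul : mpow (M i) P * restr (Φ j) = restr (subst Φ (f i j)) := by
    refine MvPowerSeries.ext fun R => ?_
    rw [coeff_mul, hrestr, h.coeff_subst_eq]
    split_ifs with hR
    · refine Finset.sum_congr rfl fun x hx => ?_
      rw [Finset.HasAntidiagonal.mem_antidiagonal] at hx
      rw [hrestr]
      split_ifs with hx2
      · rw [congrFun hx2 i, mul_comm]
      · rw [mul_zero, eq_comm]
        by_contra hcon
        refine hx2 ?_
        rw [← hR, ← hx]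
        exact funext fun m => (hshift (right_ne_zero_of_mul hcon) m).symm
    · refine Finset.sum_eq_zero fun x hx => ?_
      rw [Finset.HasAntidiagonal.mem_antidiagonal] at hx
      by_contra hcon
      have h2 := right_ne_zero_of_mul hcon
      rw [hrestr] at h2
      have h3 : (fun m => mpow (M m) x.2) = (fun m => mpow (M m) P) := by
        by_contra hcon
        exact h2 (if_neg hcon)
      refine hR ?_
      rw [← h3, ← hx]
      exact funext fun m => hshift (left_ne_zero_of_mul hcon) m
  have hdiv : (mpow (M i) P - C (μ i j)) * restr (Φ j) = restr (remainder μ f Φ i j) := by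
    rw [sub_mul, hmul]
    refine MvPowerSeries.ext fun R => ?_
    rw [map_sub, coeff_C_mul, hrestr, hrestr, hrestr, remainder, map_sub, coeff_C_mul]
    split_ifs <;> ring
  have hsol : restr (Φ j) = (mpow (M i) P - C (μ i j))⁻¹ * restr (remainder μ f Φ i j) := by
    rw [← hdiv, ← mul_assoc, MvPowerSeries.inv_mul_cancel _ hne, one_mul]
  have := congrArg (coeff P) hsol
  rw [hrestr, if_pos rfl, coeff_mul] at this
  rw [this]
  exact Finset.sum_congr rfl fun x _ => by rw [hrestr]

lemma NormalizedIntegration.remainder_fixesOrigin (h : NormalizedIntegration μ f Φ M)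
    (hf : ∀ i, (f i).FixesOrigin) (i : Fin ℓ) (j : Fin n) :
    constantCoeff (remainder μ f Φ i j) = 0 := by
  rw [remainder, map_sub, map_mul, h.normalized.1 j, mul_zero, sub_zero]
  exact comp_fixesOrigin (hf i) h.normalized.1 j

/-- The solution formula is a convolution whose kernel depends on the exponent only through its
class. A uniform bound on the kernels therefore bounds the whole nonresonant part. -/
lemma NormalizedIntegration.nrm_sub_X_le (h : NormalizedIntegration μ f Φ M)
    (hμ : ∀ i j, μ i j ≠ 0) (hf : ∀ i, (f i).FixesOrigin) {N : ℕ} {r K : ℝ} (hr : 0 ≤ r)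
    (hK : 0 ≤ K)
    (hdiv : ∀ j P, (∃ m, mpow (μ m) P ≠ μ m j) →
      ∃ i, mpow (μ i) P ≠ μ i j ∧ nrm N r (mpow (M i) P - C (μ i j))⁻¹ ≤ K) (j : Fin n) :
    nrm (N + 1) r (Φ j - X j) ≤ K * ∑ i, nrm (N + 1) r (remainder μ f Φ i j) := by
  classical
  let good : (Fin ℓ → MvPowerSeries (Fin n) ℂ) → Fin ℓ → Prop := fun ω i =>
    constantCoeff (ω i) ≠ μ i j ∧ nrm N r (ω i - C (μ i j))⁻¹ ≤ K
  -- The index `i` is chosen once per class, so that all exponents of a class share one kernel; the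
  -- value `0` for other tuples keeps the bound `K` valid everywhere.
  let k : (Fin ℓ → MvPowerSeries (Fin n) ℂ) → MvPowerSeries (Fin n) ℂ := fun ω =>
    if hω : ∃ i, good ω i then (ω hω.choose - C (μ hω.choose j))⁻¹ else 0
  have hk : ∀ ω, nrm N r (k ω) ≤ K := by
    intro ω
    by_cases hω : ∃ i, good ω i
    · simp only [k, dif_pos hω]
      exact hω.choose_spec.2
    · simp only [k, dif_neg hω]
      simpa [nrm] using hK
  have hw : ∀ (m : Fin ℓ) (P : Fin n →₀ ℕ), constantCoeff (mpow (M m) P) = mpow (μ m) P :=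
    fun m P => by rw [constantCoeff_mpow, funext (h.constantCoeff_eq m)]
  have hsum : ∑ i, nrm (N + 1) r (remainder μ f Φ i j)
      = ∑ Q ∈ box n (N + 1), (∑ i, ‖coeff Q (remainder μ f Φ i j)‖) * r ^ Q.degree := by
    simp only [nrm, Finset.sum_mul]
    rw [Finset.sum_comm]
  rw [hsum]
  refine le_trans (Finset.sum_le_sum fun P _ => ?_) (sum_box_antidiagonal_le (N := N + 1) hr
    (a := fun R Q => ‖coeff R (k fun m => mpow (M m) Q)‖)
    (b := fun Q => ∑ i, ‖coeff Q (remainder μ f Φ i j)‖)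
    (fun Q => Finset.sum_nonneg fun _ _ => norm_nonneg _) fun Q _ hQ => ?_)
  · gcongr
    have hnn : 0 ≤ ∑ x ∈ Finset.HasAntidiagonal.antidiagonal P,
        ‖coeff x.1 (k fun m => mpow (M m) x.2)‖ * ∑ i, ‖coeff x.2 (remainder μ f Φ i j)‖ :=
      Finset.sum_nonneg fun _ _ => mul_nonneg (norm_nonneg _)
        (Finset.sum_nonneg fun _ _ => norm_nonneg _)
    by_cases hres : ∃ m, mpow (μ m) P ≠ μ m j
    · have hgood : ∃ i, good (fun m => mpow (M m) P) i := by
        obtain ⟨i, hi, hi'⟩ := hdiv j P hres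
        exact ⟨i, by rw [hw]; exact hi, hi'⟩
      have hspec := hgood.choose_spec.1
      rw [hw] at hspec
      have hX : coeff P (X j : MvPowerSeries (Fin n) ℂ) = 0 := by
        rw [coeff_X, if_neg]
        rintro rfl
        obtain ⟨m, hm⟩ := hres
        exact hm (mpow_single_one _ _)
      rw [map_sub, hX, sub_zero, h.coeff_eq_sum hμ hspec]
      refine (norm_sum_le _ _).trans (Finset.sum_le_sum fun x _ => ?_)
      rw [norm_mul]
      split_ifs with hx
      · have hkx : k (fun m => mpow (M m) x.2)
            = (mpow (M hgood.choose) P - C (μ hgood.choose j))⁻¹ := by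
          rw [hx]
          exact dif_pos hgood
        rw [hkx]
        gcongr
        exact Finset.single_le_sum (f := fun i => ‖coeff x.2 (remainder μ f Φ i j)‖)
          (fun _ _ => norm_nonneg _) (Finset.mem_univ _)
      · rw [norm_zero, mul_zero]
        exact mul_nonneg (norm_nonneg _) (Finset.sum_nonneg fun _ _ => norm_nonneg _)
    · push Not at hres
      have : coeff P (Φ j - X j) = 0 := by
        rw [map_sub]
        rcases Nat.lt_or_ge P.degree 2 with h2 | h2
        · rcases Nat.lt_or_ge P.degree 1 with h1 | h1
          · rw [← map_sub]
            exact vanishBelow_one_sub h.normalized.1 idMap_fixesOrigin j P h1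
          · obtain ⟨i, rfl⟩ := degree_eq_one (by omega : P.degree = 1)
            have e1 := congrFun (congrFun h.normalized.2.1 j) i
            have e2 := congrFun (congrFun (linearPart_idMap (n := n)) j) i
            exact sub_eq_zero.2 (e1.trans e2.symm)
        · rw [h.normalized.2.2 j P h2 hres, coeff_X, if_neg, sub_zero]
          rintro rfl
          simp at h2
      rw [this, norm_zero]
      exact hnn
  · refine (Finset.sum_le_sum_of_subset_of_nonneg (box_mono ?_) fun _ _ _ => by positivity).trans
      (hk fun m => mpow (M m) Q)
    -- The remainder has no constant term, so the kernel enters only through degrees at most `N`,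
    -- one less than the degree reached in `Φ`.
    rcases Nat.eq_zero_or_pos Q.degree with h0 | hpos
    · exfalso
      refine hQ (Finset.sum_eq_zero fun i _ => ?_)
      rw [vanishBelow_one_iff.2 (h.remainder_fixesOrigin hf i j) Q (by omega), norm_zero]
    · omega

/-- The difference `R` of comparable exponents has weight `1`, so `M_m^R = 1`. This is the role of
the comparability of `Q` and `Q'` in the Poincaré condition. -/
lemma NormalizedIntegration.mpow_eq_of_comparable (h : NormalizedIntegration μ f Φ M)
    (hμ : ∀ i j, μ i j ≠ 0) {P Q : Fin n →₀ ℕ} (hPQ : P ≤ Q)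
    (heq : ∀ m, mpow (μ m) P = mpow (μ m) Q) (m : Fin ℓ) : mpow (M m) P = mpow (M m) Q := by
  obtain ⟨R, rfl⟩ := le_iff_exists_add.1 hPQ
  have hR : ∀ m, mpow (μ m) R = 1 := fun m => by
    have := heq m
    rw [mpow_add] at this
    exact (mul_eq_left₀ (mpow_ne_zero (hμ m) P)).1 this.symm
  rw [mpow_add, h.mpow_eq_one hμ hR, mul_one]

lemma NormalizedIntegration.exists_divisor_bound (h : NormalizedIntegration μ f Φ M)
    (hμ : ∀ i j, μ i j ≠ 0) (hP : DiagonalPoincareType μ) :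
    ∃ K > 0, ∃ ε > 0, ∀ (N : ℕ) (r : ℝ), 0 ≤ r →
      (∀ i j, nrm N r (M i j - C (μ i j)) ≤ ε) →
      ∀ j P, (∃ m, mpow (μ m) P ≠ μ m j) →
        ∃ i, mpow (μ i) P ≠ μ i j ∧ nrm N r (mpow (M i) P - C (μ i j))⁻¹ ≤ K := by
  obtain ⟨d, c, hd, hc, hP⟩ := hP
  choose K hK ε hε hbound using fun i j =>
    exists_nrm_inv_le (n := n) (hμ i) (hμ i j) hd hc
  -- A tolerance for `M - μ` that makes every quotient `M_{ik} / μ_{ik}` close enough to `1`.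
  obtain ⟨η, hη, hηle⟩ : ∃ η > 0, ∀ i j k, ‖(μ i k)⁻¹‖ * η ≤ ε i j := by
    have : ∀ᶠ η in 𝓝[>] (0 : ℝ), ∀ i j k, ‖(μ i k)⁻¹‖ * η ≤ ε i j := by
      refine eventually_all.2 fun i => eventually_all.2 fun j => eventually_all.2 fun k => ?_
      have ht : Tendsto (fun η : ℝ => ‖(μ i k)⁻¹‖ * η) (𝓝[>] 0) (𝓝 0) := by
        have : Tendsto (fun η : ℝ => ‖(μ i k)⁻¹‖ * η) (𝓝 0) (𝓝 (‖(μ i k)⁻¹‖ * 0)) :=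
          tendsto_id.const_mul _
        rw [mul_zero] at this
        exact this.mono_left nhdsWithin_le_nhds
      exact (ht.eventually (gt_mem_nhds (hε i j))).mono fun _ h => h.le
    obtain ⟨η, h1, h2⟩ := (this.and self_mem_nhdsWithin).exists
    exact ⟨η, h2, h1⟩
  refine ⟨∑ i, ∑ j, K i j + 1, ?_, η, hη, ?_⟩
  · have := Finset.sum_nonneg fun i (_ : i ∈ Finset.univ) =>
      Finset.sum_nonneg fun j (_ : j ∈ Finset.univ) => (hK i j).le
    linarith
  intro N r hr hM j P hres
  obtain ⟨i, Q, hQP, hQ, hmax, hcomp⟩ := hP j P hres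
  -- The divisor of `P` is the divisor of the exponent supplied by the Poincaré condition, where the
  -- exponential bound holds.
  have hQP' : ∀ m, mpow (M m) Q = mpow (M m) P := by
    rcases hcomp with hle | hle
    · exact fun m => (h.mpow_eq_of_comparable hμ hle (fun m => (hQP m).symm) m).symm
    · exact h.mpow_eq_of_comparable hμ hle hQP
  refine ⟨i, fun h' => hQ ((hQP i).trans h'), ?_⟩
  rw [← hQP']
  have hfac : mpow (M i) Q = C (mpow (μ i) Q) * mpow (fun k => C (μ i k)⁻¹ * M i k) Q := by
    rw [← mpow_C, ← mpow_mul]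
    congr 1
    funext k
    rw [← mul_assoc, ← map_mul, mul_inv_cancel₀ (hμ i k), map_one, one_mul]
  rw [hfac]
  refine (hbound i j N r hr (fun k => C (μ i k)⁻¹ * M i k) (fun k => ?_) (fun k => ?_) Q hQ
    hmax).trans ?_
  · rw [map_mul, constantCoeff_C, h.constantCoeff_eq, inv_mul_cancel₀ (hμ i k)]
  · have e : C (μ i k)⁻¹ * M i k - 1 = C (μ i k)⁻¹ * (M i k - C (μ i k)) := by
      rw [mul_sub, ← map_mul, inv_mul_cancel₀ (hμ i k), map_one]
    rw [e, nrm_C_mul]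
    exact (mul_le_mul_of_nonneg_left (hM i k) (norm_nonneg _)).trans (hηle i j k)
  · have h1 := Finset.single_le_sum (f := fun j => K i j) (fun j _ => (hK i j).le)
      (Finset.mem_univ j)
    have h2 := Finset.single_le_sum (f := fun i => ∑ j, K i j)
      (fun i _ => Finset.sum_nonneg fun j _ => (hK i j).le) (Finset.mem_univ i)
    linarith

lemma Converges.exists_common {ι : Type*} [Finite ι] {g : ι → MvPowerSeries (Fin n) ℂ}
    (hg : ∀ i, Converges (g i)) : ∃ ρ > 0, ∃ B, 0 ≤ B ∧ ∀ i N, nrm N ρ (g i) ≤ B := by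
  have := Fintype.ofFinite ι
  choose ρ hρ B hB using hg
  obtain ⟨η, hη, hle⟩ : ∃ η > 0, ∀ i, η ≤ ρ i := by
    have : ∀ᶠ η in 𝓝[>] (0 : ℝ), ∀ i, η ≤ ρ i := eventually_all.2 fun i =>
      ((gt_mem_nhds (hρ i)).filter_mono nhdsWithin_le_nhds).mono fun _ h => h.le
    obtain ⟨η, h1, h2⟩ := (this.and self_mem_nhdsWithin).exists
    exact ⟨η, h2, h1⟩
  have hB0 : ∀ i, 0 ≤ B i := fun i => (nrm_nonneg (hρ i).le _).trans (hB i 0)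
  refine ⟨η, hη, ∑ i, B i, Finset.sum_nonneg fun i _ => hB0 i, fun i N => ?_⟩
  exact (nrm_mono_radius hη.le (hle i) _).trans ((hB i N).trans
    (Finset.single_le_sum (fun i _ => hB0 i) (Finset.mem_univ i)))

/-- The remainder is `R ∘ Φ`, with `R` the part of `f_{ij}` of order two. Its terms of degree `N +
2` use `Φ` only through degree `N + 1`, and order two yields the factor `r²`. -/
lemma NormalizedIntegration.exists_remainder_bound (h : NormalizedIntegration μ f Φ M)
    (hf : ∀ i, (f i).FixesOrigin) (hlin : ∀ i, (f i).linearPart = Matrix.diagonal (μ i))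
    (hconv : ∀ i j, Converges (f i j)) :
    ∃ K, 0 ≤ K ∧ ∃ ρ > 0, ∀ (N : ℕ) (r : ℝ), 0 < r → r ≤ ρ →
      (∀ j, nrm (N + 1) r (Φ j - X j) ≤ r) →
      ∀ i j, nrm (N + 2) r (remainder μ f Φ i j) ≤ K * r ^ 2 := by
  obtain ⟨ρ, hρ, B, hB0, hB⟩ := Converges.exists_common
    (g := fun x : Fin ℓ × Fin n => f x.1 x.2) fun x => hconv x.1 x.2
  set L := ∑ i, ∑ j, ‖μ i j‖ with hL
  have hLle : ∀ i j, ‖μ i j‖ ≤ L := fun i j =>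
    (Finset.single_le_sum (f := fun j => ‖μ i j‖) (fun _ _ => norm_nonneg _)
      (Finset.mem_univ j)).trans (Finset.single_le_sum (f := fun i => ∑ j, ‖μ i j‖)
        (fun _ _ => Finset.sum_nonneg fun _ _ => norm_nonneg _) (Finset.mem_univ i))
  have hL0 : 0 ≤ L := Finset.sum_nonneg fun _ _ => Finset.sum_nonneg fun _ _ => norm_nonneg _
  refine ⟨(2 / ρ) ^ 2 * (B + L * ρ), by positivity, ρ / 2, by positivity, ?_⟩
  intro N r hr hrρ hΦ i j
  set R := f i j - C (μ i j) * X j with hR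
  have hR2 : VanishBelow 2 R := by
    intro P hP
    rcases Nat.lt_or_ge P.degree 1 with h1 | h1
    · refine vanishBelow_one_iff.2 ?_ P h1
      rw [hR, map_sub, hf i j, map_mul, constantCoeff_X, mul_zero, sub_zero]
    · obtain ⟨k, rfl⟩ := degree_eq_one (by omega : P.degree = 1)
      have e1 := congrFun (congrFun ((hlin i).trans (linearPart_diagMap (μ i)).symm) j) k
      rw [hR, map_sub]
      exact sub_eq_zero.2 e1
  have hΦ0 := h.normalized.1
  have hG : remainder μ f Φ i j = subst Φ R := by
    rw [remainder, hR, subst_sub hΦ0.hasSubst, subst_mul hΦ0.hasSubst, subst_C' hΦ0,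
      subst_X hΦ0.hasSubst]
  -- `Φ` is cut off at degree `N + 1` because its norm at level `N + 2` is not yet controlled.
  let T : FormalMap n := fun k P => if P.degree ≤ N + 1 then coeff P (Φ k) else 0
  have hT : ∀ k P, coeff P (T k) = if P.degree ≤ N + 1 then coeff P (Φ k) else 0 := fun k P => rfl
  have hT0 : T.FixesOrigin := fun k => by
    rw [← coeff_zero_eq_constantCoeff_apply, hT, if_pos (by simp),
      coeff_zero_eq_constantCoeff_apply, hΦ0 k]
  have hcongr : nrm (N + 2) r (subst Φ R) = nrm (N + 2) r (subst T R) :=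
    nrm_congr fun P hP => coeff_subst_congr hΦ0 hT0 (M := N + 1) (fun k Q hQ => by
      rw [map_sub, hT, if_pos (by omega), sub_self]) hR2 hP
  have hTn : ∀ k, nrm (N + 2) r (T k) ≤ 2 * r := by
    intro k
    have e : nrm (N + 2) r (T k) = nrm (N + 1) r (Φ k) := by
      unfold nrm
      rw [← Finset.sum_subset (box_mono (by omega : N + 1 ≤ N + 2))]
      · exact Finset.sum_congr rfl fun Q hQ => by rw [hT, if_pos (mem_box.1 hQ)]
      · intro Q _ hQ
        rw [hT, if_neg (fun h => hQ (mem_box.2 h)), norm_zero, zero_mul]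
    rw [e, show Φ k = (Φ k - X k) + X k by ring]
    have := nrm_add_le (N := N + 1) hr.le (Φ k - X k) (X k)
    have := nrm_X_le (N := N + 1) hr.le k
    have := hΦ k
    linarith
  have hRn : nrm (N + 2) ρ R ≤ B + L * ρ := by
    rw [hR]
    refine (nrm_sub_le hρ.le _ _).trans (add_le_add (hB (i, j) _) ?_)
    rw [nrm_C_mul]
    exact mul_le_mul (hLle i j) (nrm_X_le hρ.le j) (nrm_nonneg hρ.le _) hL0
  rw [hG, hcongr]
  calc nrm (N + 2) r (subst T R) ≤ nrm (N + 2) (2 * r) R := nrm_subst_le hr.le hT0 hTn R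
    _ ≤ (2 * r / ρ) ^ 2 * nrm (N + 2) ρ R :=
      nrm_le_of_vanishBelow (by positivity) hρ (by linarith) hR2
    _ ≤ (2 * r / ρ) ^ 2 * (B + L * ρ) := by gcongr
    _ = _ := by ring

/-- Normalized integrations of Poincaré type converge. -/
theorem NormalizedIntegration.converges (h : NormalizedIntegration μ f Φ M)
    (hμ : ∀ i j, μ i j ≠ 0) (hf : ∀ i, (f i).FixesOrigin)
    (hlin : ∀ i, (f i).linearPart = Matrix.diagonal (μ i))
    (hconv : ∀ i j, Converges (f i j)) (hP : DiagonalPoincareType μ) :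
    (∀ j, Converges (Φ j)) ∧ ∀ i j, Converges (M i j) := by
  obtain ⟨C₁, hC₁, ε, hε, hdiv⟩ := h.exists_divisor_bound hμ hP
  obtain ⟨K, hK, ρ, hρ, hrem⟩ := h.exists_remainder_bound hf hlin hconv
  -- Small enough that `K r ≤ ε` closes the estimate for `M` and `C₁ ℓ K r ≤ 1` the one for `Φ`.
  set r : ℝ := min ρ (min (ε / (K + 1)) (1 / (C₁ * (ℓ * K) + 1))) with hr_def
  have hr : 0 < r := by positivity
  have hrρ : r ≤ ρ := min_le_left _ _
  have hrε : K * r ≤ ε := by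
    have h1 : r ≤ ε / (K + 1) := (min_le_right _ _).trans (min_le_left _ _)
    rw [le_div_iff₀ (by positivity)] at h1
    linarith
  have hrC : C₁ * (ℓ * K) * r ≤ 1 := by
    have h1 : r ≤ 1 / (C₁ * (ℓ * K) + 1) := (min_le_right _ _).trans (min_le_right _ _)
    rw [le_div_iff₀ (by positivity)] at h1
    linarith
  have hlinX : ∀ j, VanishBelow 2 (Φ j - X j) := by
    intro j P hP
    rcases Nat.lt_or_ge P.degree 1 with h1 | h1
    · exact vanishBelow_one_sub h.normalized.1 idMap_fixesOrigin j P h1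
    · obtain ⟨i, rfl⟩ := degree_eq_one (by omega : P.degree = 1)
      have e1 := congrFun (congrFun (h.normalized.2.1.trans linearPart_idMap.symm) j) i
      rw [map_sub]
      exact sub_eq_zero.2 e1
  -- The induction runs from `Φ` through degree `N + 1` to the remainder through `N + 2`, then to
  -- `M` through `N + 1`, then to `Φ` through `N + 2`, always at the same radius.
  have key : ∀ N, (∀ j, nrm (N + 1) r (Φ j - X j) ≤ r) ∧
      ∀ i j, nrm N r (M i j - C (μ i j)) ≤ ε := by
    intro N
    induction N with
    | zero =>
      constructor
      · intro j
        refine le_trans (le_of_eq ?_) hr.le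
        exact Finset.sum_eq_zero fun Q hQ => by
          rw [hlinX j Q (by rw [mem_box] at hQ; omega), norm_zero, zero_mul]
      · intro i j
        refine le_trans (le_of_eq ?_) hε.le
        refine Finset.sum_eq_zero fun Q hQ => ?_
        rw [vanishBelow_one_iff.2 _ Q (by rw [mem_box] at hQ; omega), norm_zero, zero_mul]
        rw [map_sub, h.constantCoeff_eq, constantCoeff_C, sub_self]
    | succ N ih =>
      have hG := hrem N r hr hrρ ih.1
      have hM : ∀ i j, nrm (N + 1) r (M i j - C (μ i j)) ≤ ε := by
        intro i j
        -- The coefficient of `x^R` in `M_{ij}` is matched with that of `x^R x_j` in the remainder,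
        -- which costs one factor `r`.
        have h1 : nrm (N + 1) r (M i j - C (μ i j)) * r ≤ nrm (N + 2) r (remainder μ f Φ i j) := by
          classical
          unfold nrm
          rw [Finset.sum_mul]
          calc ∑ R ∈ box n (N + 1), ‖coeff R (M i j - C (μ i j))‖ * r ^ R.degree * r
              ≤ ∑ R ∈ box n (N + 1), ‖coeff (R + Finsupp.single j 1) (remainder μ f Φ i j)‖
                  * r ^ (R + Finsupp.single j 1).degree := by
                refine Finset.sum_le_sum fun R _ => ?_
                rw [map_add, Finsupp.degree_single, pow_succ, mul_assoc]
                gcongr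
                by_cases hR : R = 0
                · rw [hR, coeff_zero_eq_constantCoeff_apply, map_sub, h.constantCoeff_eq,
                    constantCoeff_C, sub_self, norm_zero]
                  exact norm_nonneg _
                · rw [map_sub, coeff_C, if_neg hR, sub_zero]
                  exact h.norm_coeff_le i j hR
            _ = ∑ Q ∈ (box n (N + 1)).map (addRightEmbedding (Finsupp.single j 1)),
                  ‖coeff Q (remainder μ f Φ i j)‖ * r ^ Q.degree := by
                rw [Finset.sum_map]; rfl
            _ ≤ _ := by
                refine Finset.sum_le_sum_of_subset_of_nonneg ?_ fun _ _ _ => by positivity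
                intro Q hQ
                obtain ⟨R, hR, rfl⟩ := Finset.mem_map.1 hQ
                rw [mem_box] at hR ⊢
                simp only [addRightEmbedding_apply, map_add, Finsupp.degree_single]
                omega
        have h2 := h1.trans (hG i j)
        rw [pow_two, ← mul_assoc] at h2
        exact (le_of_mul_le_mul_right h2 hr).trans hrε
      refine ⟨fun j => ?_, hM⟩
      refine (h.nrm_sub_X_le hμ hf hr.le hC₁.le (hdiv (N + 1) r hr.le hM) j).trans ?_
      have hsum : ∑ i, nrm (N + 1 + 1) r (remainder μ f Φ i j) ≤ ℓ * (K * r ^ 2) := by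
        refine (Finset.sum_le_sum fun i _ => hG i j).trans (le_of_eq ?_)
        simp
      calc C₁ * ∑ i, nrm (N + 1 + 1) r (remainder μ f Φ i j) ≤ C₁ * (ℓ * (K * r ^ 2)) := by gcongr
        _ = C₁ * (ℓ * K) * r * r := by ring
        _ ≤ 1 * r := by gcongr
        _ = r := one_mul r
  refine ⟨fun j => ⟨r, hr, r + r, fun N => ?_⟩, fun i j => ⟨r, hr, ε + ‖μ i j‖, fun N => ?_⟩⟩
  · have h1 := nrm_add_le (N := N) hr.le (Φ j - X j) (X j)
    rw [sub_add_cancel] at h1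
    have h2 := (nrm_mono hr.le (Nat.le_succ N) _).trans ((key N).1 j)
    have h3 := nrm_X_le (N := N) hr.le j
    linarith
  · have h1 := nrm_add_le (N := N) hr.le (M i j - C (μ i j)) (C (μ i j))
    rw [sub_add_cancel, nrm_C] at h1
    have h2 := (key N).2 i j
    linarith

end Convergence

/-! ### Sums of convergent series, their products and compositions -/

section Sums

variable {n : ℕ}

/-- The power series `h` converges (absolutely) to `a` at the point `z`. -/
def SumsTo (h : MvPowerSeries (Fin n) ℂ) (z : Fin n → ℂ) (a : ℂ) : Prop :=
  HasSum (fun Q => coeff Q h * mpow z Q) a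

lemma SumsTo.mul {g h : MvPowerSeries (Fin n) ℂ} {z : Fin n → ℂ} {a b : ℂ} (hg : SumsTo g z a)
    (hh : SumsTo h z b) : SumsTo (g * h) z (a * b) := by
  classical
  have hmul : Summable fun x : (Fin n →₀ ℕ) × (Fin n →₀ ℕ) =>
      (coeff x.1 g * mpow z x.1) * (coeff x.2 h * mpow z x.2) :=
    summable_mul_of_summable_norm (f := fun Q => coeff Q g * mpow z Q)
      (g := fun Q => coeff Q h * mpow z Q) (summable_norm_iff.2 hg.summable)
      (summable_norm_iff.2 hh.summable)
  have hterm : (fun Q => coeff Q (g * h) * mpow z Q) = fun Q =>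
      ∑ x ∈ Finset.HasAntidiagonal.antidiagonal Q,
        (coeff x.1 g * mpow z x.1) * (coeff x.2 h * mpow z x.2) := by
    funext Q
    rw [coeff_mul, Finset.sum_mul]
    refine Finset.sum_congr rfl fun x hx => ?_
    rw [← Finset.HasAntidiagonal.mem_antidiagonal.1 hx, mpow_add]
    ring
  unfold SumsTo
  rw [hterm, ← hg.tsum_eq, ← hh.tsum_eq,
    hg.summable.tsum_mul_tsum_eq_tsum_sum_antidiagonal hh.summable hmul]
  exact (summable_sum_mul_antidiagonal_of_summable_mul
    (f := fun Q => coeff Q g * mpow z Q) (g := fun Q => coeff Q h * mpow z Q) hmul).hasSum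

lemma SumsTo.add {g h : MvPowerSeries (Fin n) ℂ} {z : Fin n → ℂ} {a b : ℂ} (hg : SumsTo g z a)
    (hh : SumsTo h z b) : SumsTo (g + h) z (a + b) := by
  simpa only [SumsTo, map_add, add_mul] using HasSum.add hg hh

lemma sumsTo_C (a : ℂ) (z : Fin n → ℂ) : SumsTo (C a) z a := by
  classical
  have := hasSum_single (f := fun Q => coeff Q (C a : MvPowerSeries (Fin n) ℂ) * mpow z Q) 0
    fun Q hQ => by rw [coeff_C, if_neg hQ, zero_mul]
  simpa [SumsTo] using this

lemma sumsTo_X (k : Fin n) (z : Fin n → ℂ) : SumsTo (X k) z (z k) := by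
  classical
  have := hasSum_single (f := fun Q => coeff Q (X k : MvPowerSeries (Fin n) ℂ) * mpow z Q)
    (Finsupp.single k 1) fun Q hQ => by rw [coeff_X, if_neg hQ, zero_mul]
  simpa [SumsTo, mpow_single_one] using this

lemma SumsTo.mpow {g : Fin n → MvPowerSeries (Fin n) ℂ} {z a : Fin n → ℂ}
    (hg : ∀ k, SumsTo (g k) z (a k)) (Q : Fin n →₀ ℕ) :
    SumsTo (CompleteIntegrability.mpow g Q) z (CompleteIntegrability.mpow a Q) := by
  have h1 : SumsTo (1 : MvPowerSeries (Fin n) ℂ) z 1 := by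
    simpa using sumsTo_C (n := n) 1 z
  induction Q using Finsupp.induction_linear with
  | zero => simpa using h1
  | add P Q hP hQ => rw [mpow_add, mpow_add]; exact hP.mul hQ
  | single k m =>
    rw [mpow_single, mpow_single]
    induction m with
    | zero => simpa using h1
    | succ m ih => rw [pow_succ, pow_succ]; exact ih.mul (hg k)

lemma sumsTo_zero (h : MvPowerSeries (Fin n) ℂ) : SumsTo h 0 (constantCoeff h) := by
  have := hasSum_single (f := fun Q => coeff Q h * mpow (0 : Fin n → ℂ) Q) 0 fun Q hQ => by
    have : mpow (0 : Fin n → ℂ) Q = 0 := by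
      rw [show (0 : Fin n → ℂ) = fun _ => 0 from rfl, mpow_const, zero_pow]
      rwa [ne_eq, Finsupp.degree_eq_zero_iff]
    rw [this, mul_zero]
  simpa [SumsTo] using this

lemma norm_mpow_le {z : Fin n → ℂ} {r : ℝ} (hz : ‖z‖ ≤ r) (Q : Fin n →₀ ℕ) :
    ‖mpow z Q‖ ≤ r ^ Q.degree := by
  rw [norm_mpow, ← mpow_const]
  exact Finset.prod_le_prod (fun _ _ => by positivity) fun k _ =>
    pow_le_pow_left₀ (norm_nonneg _) ((norm_le_pi_norm z k).trans hz) _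

lemma summable_of_nrm_le {h : MvPowerSeries (Fin n) ℂ} {r B : ℝ} (hr : 0 ≤ r)
    (hB : ∀ N, nrm N r h ≤ B) : Summable fun Q => ‖coeff Q h‖ * r ^ Q.degree := by
  refine summable_of_sum_le (c := B) (fun Q => by positivity) fun s => ?_
  refine le_trans ?_ (hB (s.sup Finsupp.degree))
  exact Finset.sum_le_sum_of_subset_of_nonneg
    (fun Q hQ => mem_box.2 (Finset.le_sup (f := Finsupp.degree) hQ)) fun _ _ _ => by positivity

lemma tsum_le_of_nrm_le {h : MvPowerSeries (Fin n) ℂ} {r B : ℝ} (hr : 0 ≤ r)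
    (hB : ∀ N, nrm N r h ≤ B) : ∑' Q, ‖coeff Q h‖ * r ^ Q.degree ≤ B := by
  refine (summable_of_nrm_le hr hB).tsum_le_of_sum_le fun s => ?_
  refine le_trans ?_ (hB (s.sup Finsupp.degree))
  exact Finset.sum_le_sum_of_subset_of_nonneg
    (fun Q hQ => mem_box.2 (Finset.le_sup (f := Finsupp.degree) hQ)) fun _ _ _ => by positivity

lemma SumsTo.norm_le {h : MvPowerSeries (Fin n) ℂ} {r B : ℝ} (hr : 0 ≤ r)
    (hB : ∀ N, nrm N r h ≤ B) {z : Fin n → ℂ} (hz : ‖z‖ ≤ r) {a : ℂ} (ha : SumsTo h z a) :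
    ‖a‖ ≤ B := by
  have hs := summable_of_nrm_le hr hB
  have hle : ∀ Q, ‖coeff Q h * CompleteIntegrability.mpow z Q‖ ≤ ‖coeff Q h‖ * r ^ Q.degree := by
    intro Q
    rw [norm_mul]
    gcongr
    exact norm_mpow_le hz Q
  rw [← ha.tsum_eq]
  exact (tsum_of_norm_bounded hs.hasSum hle).trans (tsum_le_of_nrm_le hr hB)

lemma SumsTo.unique {h : MvPowerSeries (Fin n) ℂ} {z : Fin n → ℂ} {a b : ℂ} (ha : SumsTo h z a)
    (hb : SumsTo h z b) : a = b :=
  HasSum.unique ha hb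

/-- The sum of a power series. -/
noncomputable def evalSeries (h : MvPowerSeries (Fin n) ℂ) (z : Fin n → ℂ) : ℂ :=
  ∑' Q, coeff Q h * mpow z Q

lemma evalSeries_zero (h : MvPowerSeries (Fin n) ℂ) : evalSeries h 0 = constantCoeff h :=
  HasSum.tsum_eq (sumsTo_zero h)

lemma sumsTo_evalSeries {h : MvPowerSeries (Fin n) ℂ} {r B : ℝ} (hr : 0 ≤ r)
    (hB : ∀ N, nrm N r h ≤ B) {z : Fin n → ℂ} (hz : ‖z‖ ≤ r) : SumsTo h z (evalSeries h z) := by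
  refine (Summable.of_norm_bounded (summable_of_nrm_le hr hB) fun Q => ?_).hasSum
  rw [norm_mul]
  gcongr
  exact norm_mpow_le hz Q

/-- The convergent power series `h` is the Taylor expansion of the germ of `F`. -/
def HasSeries (F : (Fin n → ℂ) → ℂ) (h : MvPowerSeries (Fin n) ℂ) : Prop :=
  ∀ᶠ z in 𝓝 0, SumsTo h z (F z)

lemma HasSeries.eventuallyEq {F G : (Fin n → ℂ) → ℂ} {h : MvPowerSeries (Fin n) ℂ}
    (hF : HasSeries F h) (hG : HasSeries G h) : ∀ᶠ z in 𝓝 0, F z = G z := by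
  filter_upwards [hF, hG] with z h1 h2 using h1.unique h2

lemma HasSeries.apply_zero {F : (Fin n → ℂ) → ℂ} {h : MvPowerSeries (Fin n) ℂ}
    (hF : HasSeries F h) : F 0 = constantCoeff h :=
  hF.self_of_nhds.unique (sumsTo_zero h)

lemma Converges.hasSeries {h : MvPowerSeries (Fin n) ℂ} (hh : Converges h) :
    HasSeries (evalSeries h) h := by
  obtain ⟨r, hr, B, hB⟩ := hh
  filter_upwards [Metric.closedBall_mem_nhds (0 : Fin n → ℂ) hr] with z hz
  exact sumsTo_evalSeries hr.le hB (by simpa using hz)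

lemma HasSeries.exists_nrm_le {F : (Fin n → ℂ) → ℂ} {h : MvPowerSeries (Fin n) ℂ}
    (hF : HasSeries F h) : ∃ ρ > 0, (∃ B, ∀ N, nrm N ρ h ≤ B) ∧
      ∀ z : Fin n → ℂ, ‖z‖ ≤ ρ → SumsTo h z (F z) := by
  obtain ⟨ε, hε, hball⟩ := Metric.eventually_nhds_iff.1 hF
  refine ⟨ε / 2, by positivity, ?_, fun z hz => hball (by rw [dist_zero_right]; linarith)⟩
  -- Absolute convergence at the point with all coordinates `ε / 2` is exactly a bound on the norms
  -- of radius `ε / 2`.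
  have hz : dist (fun _ : Fin n => ((ε / 2 : ℝ) : ℂ)) 0 < ε := by
    rw [dist_zero_right]
    refine (pi_norm_const_le _).trans_lt ?_
    rw [Complex.norm_real, Real.norm_of_nonneg (by positivity)]
    linarith
  have hs := (hball hz).summable.norm
  refine ⟨_, fun N => le_trans (le_of_eq ?_) (hs.sum_le_tsum (box n N) fun _ _ => norm_nonneg _)⟩
  refine Finset.sum_congr rfl fun Q _ => ?_
  rw [norm_mul, mpow_const, norm_pow, Complex.norm_real, Real.norm_of_nonneg (by positivity)]

lemma HasSeries.converges {F : (Fin n → ℂ) → ℂ} {h : MvPowerSeries (Fin n) ℂ}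
    (hF : HasSeries F h) : Converges h := by
  obtain ⟨ρ, hρ, hB, -⟩ := hF.exists_nrm_le
  exact ⟨ρ, hρ, hB⟩

/-- The Taylor expansion of a composition. -/
lemma HasSeries.comp {F : (Fin n → ℂ) → ℂ} {f : MvPowerSeries (Fin n) ℂ} (hF : HasSeries F f)
    {G : (Fin n → ℂ) → Fin n → ℂ} {g : FormalMap n} (hG : ∀ k, HasSeries (fun z => G z k) (g k))
    (hg : g.FixesOrigin) : HasSeries (fun z => F (G z)) (subst g f) := by
  obtain ⟨ρ, hρ, ⟨B, hB⟩, hF⟩ := hF.exists_nrm_le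
  obtain ⟨r₀, hr₀, B₀, hB₀, hgB⟩ := Converges.exists_common fun k => (hG k).converges
  -- As the `g_k` have no constant term, shrinking the radius brings their norms below the radius
  -- `ρ` available for `f`.
  set r := min r₀ (ρ * r₀ / (B₀ + 1)) with hr_def
  have hr : 0 < r := by positivity
  have hgρ : ∀ k N, nrm N r (g k) ≤ ρ := by
    intro k N
    refine (nrm_le_of_vanishBelow hr.le hr₀ (min_le_left _ _)
      (vanishBelow_one_iff.2 (hg k))).trans ?_
    have h1 : r ≤ ρ * r₀ / (B₀ + 1) := min_le_right _ _
    rw [le_div_iff₀ (by positivity)] at h1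
    calc (r / r₀) ^ 1 * nrm N r₀ (g k) ≤ (r / r₀) ^ 1 * (B₀ + 1) := by
          gcongr; linarith [hgB k N]
      _ = r * (B₀ + 1) / r₀ := by ring
      _ ≤ ρ := by rw [div_le_iff₀ hr₀]; exact h1
  filter_upwards [eventually_all.2 hG, Metric.closedBall_mem_nhds (0 : Fin n → ℂ) hr] with z hGz hz
  have hz : ‖z‖ ≤ r := by simpa using hz
  have hGρ : ‖G z‖ ≤ ρ := (pi_norm_le_iff_of_nonneg hρ.le).2 fun k =>
    (hGz k).norm_le hr.le (hgρ k) hz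
  -- Fubini for an absolutely summable double family: summing over the monomials of `g^Q` first
  -- gives `F (G z)`, summing over `Q` first gives the series of the composition.
  let a : (Fin n →₀ ℕ) × (Fin n →₀ ℕ) → ℂ := fun x =>
    coeff x.1 f * (coeff x.2 (mpow g x.1) * mpow z x.2)
  have hQB : ∀ Q N, nrm N r (mpow g Q) ≤ ρ ^ Q.degree := fun Q N =>
    nrm_mpow_le hr.le (fun k => hgρ k N) Q
  have hna : ∀ x, ‖a x‖ ≤ ‖coeff x.1 f‖ * (‖coeff x.2 (mpow g x.1)‖ * r ^ x.2.degree) := by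
    intro x
    simp only [a, norm_mul]
    gcongr
    exact norm_mpow_le hz _
  have hsum : Summable fun x : (Fin n →₀ ℕ) × (Fin n →₀ ℕ) =>
      ‖coeff x.1 f‖ * (‖coeff x.2 (mpow g x.1)‖ * r ^ x.2.degree) := by
    have h1 : ∀ Q, Summable fun P => ‖coeff Q f‖ * (‖coeff P (mpow g Q)‖ * r ^ P.degree) :=
      fun Q => (summable_of_nrm_le hr.le (hQB Q)).mul_left _
    have h2 : ∀ Q, ∑' P, ‖coeff Q f‖ * (‖coeff P (mpow g Q)‖ * r ^ P.degree)
        ≤ ‖coeff Q f‖ * ρ ^ Q.degree := fun Q => by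
      rw [tsum_mul_left]
      exact mul_le_mul_of_nonneg_left (tsum_le_of_nrm_le hr.le (hQB Q)) (norm_nonneg _)
    have h3 : Summable fun Q => ∑' P, ‖coeff Q f‖ * (‖coeff P (mpow g Q)‖ * r ^ P.degree) :=
      Summable.of_nonneg_of_le (fun Q => tsum_nonneg fun P => by positivity) h2
        (summable_of_nrm_le hρ.le hB)
    refine (summable_prod_of_nonneg ?_).2 ⟨h1, h3⟩
    intro x
    exact mul_nonneg (norm_nonneg _) (mul_nonneg (norm_nonneg _) (pow_nonneg hr.le _))
  have hsa : Summable a := Summable.of_norm_bounded hsum hna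
  have h1 : HasSum (fun Q => coeff Q f * mpow (G z) Q) (∑' x, a x) :=
    hsa.hasSum.prod_fiberwise fun Q => (SumsTo.mpow hGz Q).mul_left (coeff Q f)
  have h2 : HasSum (fun P => coeff P (subst g f) * mpow z P) (∑' x, a x) := by
    refine ((Equiv.prodComm _ _).hasSum_iff.2 hsa.hasSum).prod_fiberwise fun P => ?_
    rw [coeff_subst_eq_sum_box hg f le_rfl, Finset.sum_mul]
    have e : ∀ Q, (a ∘ Equiv.prodComm (Fin n →₀ ℕ) (Fin n →₀ ℕ)) (P, Q)
        = coeff Q f * coeff P (mpow g Q) * mpow z P := fun Q => (mul_assoc _ _ _).symm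
    simp only [e]
    refine hasSum_sum_of_ne_finset_zero fun Q hQ => ?_
    rw [mem_box, not_le] at hQ
    rw [vanishBelow_mpow hg Q P hQ, mul_zero, zero_mul]
  rw [show F (G z) = ∑' x, a x from (hF (G z) hGρ).unique h1]
  exact h2

end Sums

/-! ### Analyticity, derivatives and local inverses -/

section Analytic

variable {n : ℕ}

/-- A monomial of degree `m` is a product of `m` coordinates, one for each argument of the
multilinear map. -/
lemma exists_multilinear_mpow (m : ℕ) (Q : Fin n →₀ ℕ) :
    ∃ T : ContinuousMultilinearMap ℂ (fun _ : Fin m => Fin n → ℂ) ℂ, ‖T‖ ≤ 1 ∧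
      (Q.degree = m → ∀ z, T (fun _ => z) = mpow z Q) := by
  have hw : ∀ (m : ℕ) (Q : Fin n →₀ ℕ), Q.degree = m →
      ∃ w : Fin m → Fin n, ∀ z : Fin n → ℂ, ∏ i, z (w i) = mpow z Q := by
    intro m
    induction m with
    | zero =>
      intro Q hQ
      refine ⟨Fin.elim0, fun z => ?_⟩
      rw [Finsupp.degree_eq_zero_iff] at hQ
      simp [hQ]
    | succ m ih =>
      intro Q hQ
      have hne : Q ≠ 0 := by rintro rfl; simp at hQ
      obtain ⟨k, hk⟩ := Finsupp.ne_iff.1 hne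
      have hle : Finsupp.single k 1 ≤ Q := by
        rw [Finsupp.single_le_iff]; exact Nat.one_le_iff_ne_zero.2 hk
      obtain ⟨R, rfl⟩ := le_iff_exists_add.1 hle
      rw [map_add, Finsupp.degree_single] at hQ
      obtain ⟨w, hw⟩ := ih R (by omega)
      refine ⟨Fin.cons k w, fun z => ?_⟩
      rw [Fin.prod_univ_succ, mpow_add, mpow_single_one]
      simp [hw]
  by_cases hQ : Q.degree = m
  · obtain ⟨w, hw⟩ := hw m Q hQ
    refine ⟨(ContinuousMultilinearMap.mkPiAlgebraFin ℂ m ℂ).compContinuousLinearMap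
      fun i => ContinuousLinearMap.proj (w i), ?_, fun _ z => ?_⟩
    · refine ContinuousMultilinearMap.opNorm_le_bound zero_le_one fun v => ?_
      simp only [ContinuousMultilinearMap.compContinuousLinearMap_apply,
        ContinuousMultilinearMap.mkPiAlgebraFin_apply, List.prod_ofFn, norm_prod, one_mul,
        ContinuousLinearMap.proj_apply]
      exact Finset.prod_le_prod (fun _ _ => norm_nonneg _) fun i _ => norm_le_pi_norm (v i) (w i)
    · simp only [ContinuousMultilinearMap.compContinuousLinearMap_apply,
        ContinuousMultilinearMap.mkPiAlgebraFin_apply, List.prod_ofFn,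
        ContinuousLinearMap.proj_apply, hw]
  · exact ⟨0, by simp, fun h => absurd h hQ⟩

/-- The sum of a convergent power series is analytic, with the expected derivative. -/
lemma HasSeries.exists_hasFPowerSeriesAt {F : (Fin n → ℂ) → ℂ} {h : MvPowerSeries (Fin n) ℂ}
    (hF : HasSeries F h) : ∃ p : FormalMultilinearSeries ℂ (Fin n → ℂ) ℂ,
      HasFPowerSeriesAt F p 0 ∧
      ∀ z, p 1 (fun _ => z) = ∑ k, coeff (Finsupp.single k 1) h * z k := by
  classical
  obtain ⟨ρ, hρ, ⟨B, hB⟩, hF⟩ := hF.exists_nrm_le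
  choose T hT1 hT using fun m (Q : Fin n →₀ ℕ) => exists_multilinear_mpow m Q
  let c : ℕ → (Fin n →₀ ℕ) → ℂ := fun m Q => if Q.degree = m then coeff Q h else 0
  let p : FormalMultilinearSeries ℂ (Fin n → ℂ) ℂ := fun m => ∑ Q ∈ box n m, c m Q • T m Q
  have hp : ∀ m z, p m (fun _ => z) = ∑ Q ∈ box n m, if Q.degree = m then coeff Q h * mpow z Q
      else 0 := by
    intro m z
    simp only [p, c, sum_apply, smul_apply]
    refine Finset.sum_congr rfl fun Q _ => ?_
    split_ifs with hQ
    · rw [hT m Q hQ, smul_eq_mul]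
    · rw [zero_smul]
  refine ⟨p, ⟨ENNReal.ofReal ρ, ?_, by simpa using hρ, ?_⟩, ?_⟩
  · refine p.le_radius_of_bound (r := ρ.toNNReal) B fun m => ?_
    rw [Real.coe_toNNReal _ hρ.le]
    refine le_trans ?_ (hB m)
    calc ‖p m‖ * ρ ^ m ≤ (∑ Q ∈ box n m, ‖c m Q • T m Q‖) * ρ ^ m := by
          gcongr; exact norm_sum_le _ _
      _ ≤ _ := by
          rw [Finset.sum_mul]
          refine Finset.sum_le_sum fun Q _ => ?_
          by_cases hQ : Q.degree = m
          · simp only [c, if_pos hQ, norm_smul, hQ]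
            have := mul_le_mul_of_nonneg_left (hT1 m Q) (norm_nonneg (coeff Q h))
            rw [mul_one] at this
            gcongr
          · rw [show c m Q = 0 from if_neg hQ, norm_smul, norm_zero, zero_mul, zero_mul]
            positivity
  · intro y hy
    have hy' : ‖y‖ ≤ ρ := by
      rw [Metric.mem_eball, edist_zero_right, ← ofReal_norm] at hy
      exact ((ENNReal.ofReal_lt_ofReal_iff hρ).1 hy).le
    rw [zero_add]
    have hs := hF y hy'
    -- Absolute convergence permits grouping the monomials by degree.
    have hsig := (Equiv.sigmaFiberEquiv
      (fun Q : Fin n →₀ ℕ => Q.degree)).hasSum_iff.2 hs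
    refine hsig.sigma fun m => ?_
    rw [hp]
    have hind : HasSum (Set.indicator {Q : Fin n →₀ ℕ | Q.degree = m}
        fun Q => coeff Q h * mpow y Q)
        (∑ Q ∈ box n m, if Q.degree = m then coeff Q h * mpow y Q else 0) := by
      have : (Set.indicator {Q : Fin n →₀ ℕ | Q.degree = m} fun Q => coeff Q h * mpow y Q)
          = fun Q => if Q.degree = m then coeff Q h * mpow y Q else 0 := by
        funext Q
        simp [Set.indicator_apply]
      rw [this]
      refine hasSum_sum_of_ne_finset_zero fun Q hQ => ?_
      rw [if_neg]
      rintro rfl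
      exact hQ (mem_box.2 le_rfl)
    exact hasSum_subtype_iff_indicator.2 hind
  · intro z
    rw [hp, sum_box_eq_sum_single le_rfl]
    · simp [mpow_single_one]
    · intro Q hQ
      rw [if_neg hQ]

lemma HasSeries.analyticAt {F : (Fin n → ℂ) → ℂ} {h : MvPowerSeries (Fin n) ℂ}
    (hF : HasSeries F h) : AnalyticAt ℂ F 0 := by
  obtain ⟨p, hp, -⟩ := hF.exists_hasFPowerSeriesAt
  exact ⟨p, hp⟩

lemma HasSeries.hasFDerivAt {F : (Fin n → ℂ) → ℂ} {h : MvPowerSeries (Fin n) ℂ}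
    (hF : HasSeries F h) :
    HasFDerivAt F (∑ k, coeff (Finsupp.single k 1) h •
      (ContinuousLinearMap.proj k : (Fin n → ℂ) →L[ℂ] ℂ)) 0 := by
  obtain ⟨p, hp, hp1⟩ := hF.exists_hasFPowerSeriesAt
  convert! hp.hasFDerivAt using 1
  ext z
  rw [continuousMultilinearCurryFin1_apply]
  have : (Fin.snoc 0 z : Fin 1 → Fin n → ℂ) = fun _ => z := by
    funext i
    rw [show i = Fin.last 0 from Subsingleton.elim (α := Fin 1) _ _, Fin.snoc_last]
  rw [this, hp1]
  simp

variable {F : (Fin n → ℂ) → Fin n → ℂ} {f : FormalMap n}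

lemma _root_.HasTaylorExpansion.analyticAt (hF : HasTaylorExpansion F f) : AnalyticAt ℂ F 0 :=
  analyticAt_pi_iff.2 fun j => HasSeries.analyticAt (hF j)

lemma _root_.HasTaylorExpansion.hasFDerivAt (hF : HasTaylorExpansion F f) :
    HasFDerivAt F (Matrix.toLin' f.linearPart).toContinuousLinearMap 0 := by
  rw [hasFDerivAt_pi']
  intro j
  convert! HasSeries.hasFDerivAt (hF j) using 1
  ext z
  simp [Matrix.mulVec, dotProduct, FormalMap.linearPart]

lemma _root_.HasTaylorExpansion.comp (hF : HasTaylorExpansion F f)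
    {G : (Fin n → ℂ) → Fin n → ℂ} {g : FormalMap n} (hG : HasTaylorExpansion G g)
    (hg : g.FixesOrigin) : HasTaylorExpansion (fun z => F (G z)) (f.comp g) := fun j =>
  HasSeries.comp (hF j) hG hg

lemma _root_.HasTaylorExpansion.fixesOrigin (hF : HasTaylorExpansion F f) (h0 : F 0 = 0) :
    f.FixesOrigin := fun j => by
  rw [← HasSeries.apply_zero (hF j), h0]; rfl

/-- A germ that is tangent to the identity is a germ of biholomorphism. -/
lemma isGermOfBiholomorphism_of_linearPart_eq_one (hF : HasTaylorExpansion F f) (h0 : F 0 = 0)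
    (h1 : f.linearPart = 1) : IsGermOfBiholomorphism F := by
  have hA := hF.analyticAt
  have hD : HasFDerivAt F ((ContinuousLinearEquiv.refl ℂ (Fin n → ℂ) :
      (Fin n → ℂ) ≃L[ℂ] (Fin n → ℂ)) : (Fin n → ℂ) →L[ℂ] (Fin n → ℂ)) 0 := by
    have := hF.hasFDerivAt
    rw [h1, Matrix.toLin'_one] at this
    exact this
  have hC : ContDiffAt ℂ ⊤ F 0 := hA.contDiffAt
  have hS := hC.hasStrictFDerivAt' hD (by simp)
  refine ⟨hA, h0, hC.localInverse hD (by simp), ?_, ?_, ?_, hS.eventually_left_inverse⟩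
  · have := (hC.to_localInverse hD (by simp)).analyticAt
    rwa [h0] at this
  · have := hC.localInverse_apply_image hD (by simp)
    rwa [h0] at this
  · have := hS.eventually_right_inverse
    rwa [h0] at this

/-- The chain rule for `F ∘ G = id` makes the derivative of `F` at the origin surjective. -/
lemma isUnit_linearPart (hF : HasTaylorExpansion F f) (hb : IsGermOfBiholomorphism F) :
    IsUnit f.linearPart := by
  obtain ⟨-, h0, G, hG, hG0, hFG, -⟩ := hb
  have hGd := hG.differentiableAt.hasFDerivAt
  have hF' := hF.hasFDerivAt
  rw [← hG0] at hF'
  have hcomp := hF'.comp 0 hGd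
  have hid : HasFDerivAt (F ∘ G) (ContinuousLinearMap.id ℂ (Fin n → ℂ)) 0 :=
    (hasFDerivAt_id 0).congr_of_eventuallyEq hFG
  have heq := hcomp.unique hid
  rw [← Matrix.mulVec_surjective_iff_isUnit]
  intro v
  exact ⟨fderiv ℂ G 0 v, by simpa using DFunLike.congr_fun heq v⟩

end Analytic

/-! ### Independence of the Poincaré condition from the eigenbasis -/

section Poincare

variable {n ℓ : ℕ}

lemma mapDomain_mono (σ : Fin n → Fin n) {P Q : Fin n →₀ ℕ} (h : P ≤ Q) :
    P.mapDomain σ ≤ Q.mapDomain σ := by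
  obtain ⟨R, rfl⟩ := le_iff_exists_add.1 h
  rw [Finsupp.mapDomain_add]
  exact le_self_add

lemma _root_.DiagonalPoincareType.of_perm {μ ν : Fin ℓ → Fin n → ℂ} (σ : Equiv.Perm (Fin n))
    (hσ : ∀ i k, ν i k = μ i (σ k)) (h : DiagonalPoincareType ν) : DiagonalPoincareType μ := by
  obtain ⟨d, c, hd, hc, h⟩ := h
  refine ⟨d, c, hd, hc, fun j Q hQ => ?_⟩
  have hpow : ∀ i (P : Fin n →₀ ℕ), mpow (ν i) P = mpow (μ i) (P.mapDomain σ) := fun i P => by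
    rw [← mpow_comp]
    exact congrArg (fun a => mpow a P) (funext (hσ i))
  have hinv : (Q.mapDomain σ.symm).mapDomain σ = Q := by
    rw [← Finsupp.mapDomain_comp, Equiv.self_comp_symm, Finsupp.mapDomain_id]
  have hν : ∀ i, ν i (σ.symm j) = μ i j := fun i => by rw [hσ, Equiv.apply_symm_apply]
  obtain ⟨i, P, h1, h2, h3, h4⟩ := h (σ.symm j) (Q.mapDomain σ.symm) (by
    obtain ⟨m, hm⟩ := hQ
    refine ⟨m, fun he => hm ?_⟩
    have he' : mpow (ν m) (Q.mapDomain σ.symm) = ν m (σ.symm j) := he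
    rw [hpow, hinv, hν] at he'
    exact he')
  change ∀ m, mpow (ν m) P = mpow (ν m) (Q.mapDomain σ.symm) at h1
  change mpow (ν i) P ≠ ν i (σ.symm j) at h2
  change _ < max ‖mpow (ν i) P‖ ‖(mpow (ν i) P)⁻¹‖ at h3
  simp only [hpow, hinv, hν] at h1 h2 h3
  refine ⟨i, P.mapDomain σ, h1, h2, ?_, ?_⟩
  · rw [Finsupp.degree_mapDomain]
    exact h3
  · rw [← hinv]
    exact h4.imp (mapDomain_mono σ) (mapDomain_mono σ)

/-- A nonzero determinant has a nonzero term in its Leibniz expansion, which supplies a permutation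
`σ` with `A (σ k) k ≠ 0`; comparing these entries in `L_i A = A diag(ν_i)` matches the eigenvalues.
-/
lemma diagonalPoincareType_of_poincareType {L : Fin ℓ → Matrix (Fin n) (Fin n) ℂ}
    (h : PoincareType L) {μ : Fin ℓ → Fin n → ℂ} (hL : ∀ i, L i = Matrix.diagonal (μ i)) :
    DiagonalPoincareType μ := by
  obtain ⟨A, ν, hA, hLA, hν⟩ := h
  obtain ⟨σ, hσ⟩ : ∃ σ : Equiv.Perm (Fin n), ∀ k, A (σ k) k ≠ 0 := by
    by_contra hcon
    push Not at hcon
    refine hA.ne_zero ?_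
    rw [Matrix.det_apply]
    refine Finset.sum_eq_zero fun σ _ => ?_
    obtain ⟨k, hk⟩ := hcon σ
    rw [Finset.prod_eq_zero (f := fun k => A (σ k) k) (Finset.mem_univ k) hk, smul_zero]
  refine DiagonalPoincareType.of_perm σ (fun i k => ?_) hν
  have := congrFun (congrFun (hLA i) (σ k)) k
  rw [hL, Matrix.diagonal_mul, Matrix.mul_diagonal, mul_comm] at this
  exact (mul_left_cancel₀ (hσ k) this).symm

lemma ne_zero_of_isUnit_diagonal {ν : Fin n → ℂ} (h : IsUnit (Matrix.diagonal ν)) (j : Fin n) :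
    ν j ≠ 0 := by
  rw [Matrix.isUnit_diagonal] at h
  exact (h.map (Pi.evalMonoidHom _ j)).ne_zero

end Poincare

/-! ### The theorem for diagonal linear parts -/

section Diagonal

variable {n ℓ : ℕ} {F : Fin ℓ → (Fin n → ℂ) → Fin n → ℂ} {f : Fin ℓ → FormalMap n}
  {μ : Fin ℓ → Fin n → ℂ} {Φ : FormalMap n} {M : Fin ℓ → Fin n → MvPowerSeries (Fin n) ℂ}

lemma HasSeries.mul_coord {G : (Fin n → ℂ) → ℂ} {g : MvPowerSeries (Fin n) ℂ}
    (hG : HasSeries G g) (k : Fin n) : HasSeries (fun z => G z * z k) (g * X k) :=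
  Eventually.mono hG fun z hz => hz.mul (sumsTo_X k z)

/-- A convergent normalized integration is a holomorphic integration. -/
lemma NormalizedIntegration.isHolomorphicIntegration (h : NormalizedIntegration μ f Φ M)
    (hF : ∀ i, HasTaylorExpansion (F i) (f i)) (hΦ : ∀ j, Converges (Φ j))
    (hM : ∀ i j, Converges (M i j)) :
    IsHolomorphicIntegration F (fun z j => evalSeries (Φ j) z)
      (fun i j => evalSeries (M i j)) := by
  have hφ : HasTaylorExpansion (fun z j => evalSeries (Φ j) z) Φ := fun j => (hΦ j).hasSeries
  have hm : ∀ i j, HasSeries (evalSeries (M i j)) (M i j) := fun i j => (hM i j).hasSeries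
  have hm0 : ∀ i j, evalSeries (M i j) 0 = μ i j := fun i j => by
    rw [evalSeries_zero, h.constantCoeff_eq]
  have hφ0 : (fun j => evalSeries (Φ j) 0) = 0 := funext fun j => by
    rw [evalSeries_zero, h.normalized.1 j]; rfl
  have hMX : ∀ i, HasTaylorExpansion (fun z j => evalSeries (M i j) z * z j)
      (fun j => M i j * X j) := fun i j => (hm i j).mul_coord j
  refine ⟨isGermOfBiholomorphism_of_linearPart_eq_one hφ hφ0 h.normalized.2.1,
    fun i j => (hm i j).analyticAt, fun i => ?_, fun i i' j => ?_, fun j Q hQ => ?_⟩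
  -- Both sides have the same convergent Taylor expansion, so the formal identity passes to germs;
  -- invariance and resonance are transferred likewise.
  · have h1 := (hF i).comp hφ h.normalized.1
    have h2 := hφ.comp (hMX i) (mul_X_fixesOrigin _)
    rw [h.conjugacy] at h1
    filter_upwards [eventually_all.2 fun j => HasSeries.eventuallyEq (h1 j) (h2 j)] with z hz
    exact funext hz
  · have hD : ∀ k, HasSeries (fun z => evalSeries (M i' k) 0 * z k)
        (FormalMap.diagMap (μ i') k) := fun k => by
      rw [hm0]
      exact Eventually.of_forall fun z => (sumsTo_C _ z).mul (sumsTo_X k z)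
    have h1 := (hm i j).comp hD (diagMap_fixesOrigin _)
    rw [h.invariant] at h1
    exact h1.eventuallyEq (hm i j)
  · simp only [hm0]
    constructor
    · intro hres i
      have h1 : HasSeries (fun z => mpow (fun k => evalSeries (M i k) z) Q) (mpow (M i) Q) :=
        (eventually_all.2 (hm i)).mono fun z hz => SumsTo.mpow hz Q
      rw [h.resonant j Q hQ.le hres i] at h1
      exact h1.eventuallyEq (hm i j)
    · intro hev i
      have := (hev i).self_of_nhds
      simpa only [hm0] using this

/-- The theorem for families with diagonal linear parts. -/
theorem exists_convergent_normalizedIntegration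
    (hb : ∀ i, IsGermOfBiholomorphism (F i)) (hF : ∀ i, HasTaylorExpansion (F i) (f i))
    (hint : FormallyCompletelyIntegrable f)
    (hlin : ∀ i, (f i).linearPart = Matrix.diagonal (μ i)) (hP : DiagonalPoincareType μ) :
    ∃ Φ M, NormalizedIntegration μ f Φ M ∧ (∀ j, Converges (Φ j)) ∧ ∀ i j, Converges (M i j) := by
  obtain ⟨Φ₀, μ₀, hint⟩ := hint
  have hμ : ∀ i j, μ i j ≠ 0 := fun i j => by
    refine ne_zero_of_isUnit_diagonal ?_ j
    rw [← hlin]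
    exact isUnit_linearPart (hF i) (hb i)
  obtain ⟨Φ, M, h⟩ := exists_normalizedIntegration hint hlin hμ
  exact ⟨Φ, M, h, h.converges hμ (fun i => (hF i).fixesOrigin (hb i).2.1) hlin
    (fun i j => HasSeries.converges (hF i j)) hP⟩

end Diagonal

/-! ### Linear changes of coordinates -/

section Linear

variable {n ℓ : ℕ}

/-- A matrix as a formal map. -/
noncomputable def linMap (A : Matrix (Fin n) (Fin n) ℂ) : FormalMap n :=
  fun j => ∑ k, C (A j k) * X k

lemma linMap_fixesOrigin (A : Matrix (Fin n) (Fin n) ℂ) : (linMap A).FixesOrigin := fun j => by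
  simp [linMap]

lemma linMap_comp_apply (A : Matrix (Fin n) (Fin n) ℂ) {g : FormalMap n} (hg : g.FixesOrigin)
    (j : Fin n) : (linMap A).comp g j = ∑ k, C (A j k) * g k := by
  simp only [FormalMap.comp, linMap]
  rw [← coe_substAlgHom hg.hasSubst, map_sum]
  refine Finset.sum_congr rfl fun k _ => ?_
  rw [map_mul, coe_substAlgHom, subst_X hg.hasSubst, subst_C' hg]

lemma linMap_comp_linMap (A B : Matrix (Fin n) (Fin n) ℂ) :
    (linMap A).comp (linMap B) = linMap (A * B) := by
  funext j
  rw [linMap_comp_apply A (linMap_fixesOrigin B)]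
  simp only [linMap, Matrix.mul_apply, Finset.mul_sum, map_sum, Finset.sum_mul, map_mul, mul_assoc]
  rw [Finset.sum_comm]

lemma linMap_one : linMap (1 : Matrix (Fin n) (Fin n) ℂ) = FormalMap.idMap n := by
  funext j
  rw [linMap, Finset.sum_eq_single j]
  · simp [FormalMap.idMap]
  · intro k _ hk
    rw [Matrix.one_apply_ne (Ne.symm hk), map_zero, zero_mul]
  · simp

lemma linearPart_linMap (A : Matrix (Fin n) (Fin n) ℂ) : (linMap A).linearPart = A := by
  classical
  ext j k
  simp [FormalMap.linearPart, linMap, coeff_C_mul, coeff_index_single_X]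

lemma hasTaylorExpansion_linMap (A : Matrix (Fin n) (Fin n) ℂ) :
    HasTaylorExpansion (fun z => A.mulVec z) (linMap A) := fun j =>
  Eventually.of_forall fun z => by
    have : ∀ s : Finset (Fin n), SumsTo (∑ k ∈ s, C (A j k) * X k) z (∑ k ∈ s, A j k * z k) := by
      intro s
      classical
      induction s using Finset.induction_on with
      | empty => simpa using sumsTo_C (n := n) 0 z
      | insert k s hk ih =>
        rw [Finset.sum_insert hk, Finset.sum_insert hk]
        exact ((sumsTo_C _ z).mul (sumsTo_X k z)).add ih
    exact this Finset.univ

lemma _root_.FormalMap.IsBiholomorphism.linMap_comp {A B : Matrix (Fin n) (Fin n) ℂ}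
    (hAB : A * B = 1) {Φ : FormalMap n} (hΦ : Φ.IsBiholomorphism) :
    ((linMap A).comp Φ).IsBiholomorphism := by
  obtain ⟨h0, Ψ, hΨ0, h1, h2⟩ := hΦ
  have hA := linMap_fixesOrigin A
  have hB := linMap_fixesOrigin B
  refine ⟨comp_fixesOrigin hA h0, Ψ.comp (linMap B), comp_fixesOrigin hΨ0 hB, ?_, ?_⟩
  · rw [comp_assoc h0 (comp_fixesOrigin hΨ0 hB), ← comp_assoc hΨ0 hB, h1, idMap_comp hB,
      linMap_comp_linMap, hAB, linMap_one]
  · rw [comp_assoc hB (comp_fixesOrigin hA h0), ← comp_assoc hA h0, linMap_comp_linMap,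
      mul_eq_one_comm.1 hAB, linMap_one, idMap_comp h0, h2]

/-- The linear change is absorbed into the transformation, which becomes `B ∘ Φ`; the normal form is
unchanged. -/
lemma _root_.FormallyCompletelyIntegrable.conj {A B : Matrix (Fin n) (Fin n) ℂ} (hAB : A * B = 1)
    {f : Fin ℓ → FormalMap n} (hf : ∀ i, (f i).FixesOrigin)
    (h : FormallyCompletelyIntegrable f) :
    FormallyCompletelyIntegrable fun i => (linMap B).comp ((f i).comp (linMap A)) := by
  obtain ⟨Φ, μ, h⟩ := h
  have hA := linMap_fixesOrigin A
  have hB := linMap_fixesOrigin B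
  have hΦ := h.biholomorphism.1
  refine ⟨(linMap B).comp Φ, μ, h.biholomorphism.linMap_comp (mul_eq_one_comm.1 hAB), fun m => ?_,
    h.invariant, h.resonant⟩
  rw [comp_assoc (comp_fixesOrigin (hf m) hA) (comp_fixesOrigin hB hΦ),
    comp_assoc hA (comp_fixesOrigin hB hΦ), ← comp_assoc hB hΦ, linMap_comp_linMap, hAB,
    linMap_one, idMap_comp hΦ, h.conjugacy, comp_assoc hΦ (mul_X_fixesOrigin _)]

lemma isGermOfBiholomorphism_mulVec {A B : Matrix (Fin n) (Fin n) ℂ} (hAB : A * B = 1) :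
    IsGermOfBiholomorphism fun z => A.mulVec z := by
  refine ⟨(hasTaylorExpansion_linMap A).analyticAt, Matrix.mulVec_zero A, fun z => B.mulVec z,
    (hasTaylorExpansion_linMap B).analyticAt, Matrix.mulVec_zero B, ?_, ?_⟩
  · exact Eventually.of_forall fun z => by
      simp only [Matrix.mulVec_mulVec, hAB, Matrix.one_mulVec]
  · exact Eventually.of_forall fun z => by
      simp only [Matrix.mulVec_mulVec, mul_eq_one_comm.1 hAB, Matrix.one_mulVec]

lemma _root_.IsGermOfBiholomorphism.comp {F G : (Fin n → ℂ) → Fin n → ℂ}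
    (hF : IsGermOfBiholomorphism F) (hG : IsGermOfBiholomorphism G) :
    IsGermOfBiholomorphism fun z => F (G z) := by
  obtain ⟨hFa, hF0, F', hF'a, hF'0, hFF', hF'F⟩ := hF
  obtain ⟨hGa, hG0, G', hG'a, hG'0, hGG', hG'G⟩ := hG
  have hGt : Tendsto G (𝓝 0) (𝓝 0) := by simpa [ContinuousAt, hG0] using hGa.continuousAt
  have hF't : Tendsto F' (𝓝 0) (𝓝 0) := by simpa [ContinuousAt, hF'0] using hF'a.continuousAt
  refine ⟨AnalyticAt.fun_comp (by rwa [hG0]) hGa, by simp only [hG0, hF0], fun z => G' (F' z),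
    AnalyticAt.fun_comp (by rwa [hF'0]) hF'a, by simp only [hF'0, hG'0], ?_, ?_⟩
  · filter_upwards [hFF', hF't.eventually hGG'] with z h1 h2
    rw [h2, h1]
  · filter_upwards [hG'G, hGt.eventually hF'F] with z h1 h2
    rw [h2, h1]

lemma _root_.IsHolomorphicIntegration.of_conj {A B : Matrix (Fin n) (Fin n) ℂ} (hAB : A * B = 1)
    {F : Fin ℓ → (Fin n → ℂ) → Fin n → ℂ} {φ : (Fin n → ℂ) → Fin n → ℂ}
    {m : Fin ℓ → Fin n → (Fin n → ℂ) → ℂ}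
    (h : IsHolomorphicIntegration (fun i z => B.mulVec (F i (A.mulVec z))) φ m) :
    IsHolomorphicIntegration F (fun z => A.mulVec (φ z)) m := by
  refine ⟨(isGermOfBiholomorphism_mulVec hAB).comp h.biholomorphism, h.holomorphic, fun i => ?_,
    h.invariant, h.resonant⟩
  filter_upwards [h.conjugacy i] with z hz
  rw [← hz, Matrix.mulVec_mulVec, hAB, Matrix.one_mulVec]

end Linear

end CompleteIntegrability

/-! ### The main theorem -/

open CompleteIntegrability

theorem mainTheorem1 (n ℓ : ℕ)
    -- germs of biholomorphisms of `(ℂⁿ, 0)` and their Taylor expansions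
    (F : Fin ℓ → (Fin n → ℂ) → (Fin n → ℂ)) (hF : ∀ i, IsGermOfBiholomorphism (F i))
    (f : Fin ℓ → FormalMap n) (hf : ∀ i, HasTaylorExpansion (F i) (f i))
    (hint : FormallyCompletelyIntegrable f)
    (hP : PoincareType fun i => (f i).linearPart) :
    HolomorphicallyCompletelyIntegrable F ∧
    ∀ μ : Fin ℓ → Fin n → ℂ, (∀ i, (f i).linearPart = Matrix.diagonal (μ i)) →
      ∃ Φ : FormalMap n,
        -- `Φ` is the unique normalized map that transforms the family into a normal form
        (IsNormalized μ Φ ∧ TransformsToNormalForm μ f Φ) ∧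
        (∀ Ψ : FormalMap n, IsNormalized μ Ψ → TransformsToNormalForm μ f Ψ → Ψ = Φ) ∧
        -- it converges, and its sum conjugates the family to an integrable normal form
        ∃ (φ : (Fin n → ℂ) → (Fin n → ℂ)) (M : Fin ℓ → Fin n → (Fin n → ℂ) → ℂ),
          HasTaylorExpansion φ Φ ∧ IsHolomorphicIntegration F φ M ∧
          ∀ i j, M i j 0 = μ i j := by
  constructor
  -- The family is integrated in coordinates of common eigenvectors, and the result is carried back
  -- by `A`.
  · obtain ⟨A, μ, hA, hLA, hμ⟩ := hP
    have hAB : A * A⁻¹ = 1 := Matrix.mul_nonsing_inv A hA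
    have hBA : A⁻¹ * A = 1 := Matrix.nonsing_inv_mul A hA
    have hA0 := linMap_fixesOrigin A
    have hf0 : ∀ i, (f i).FixesOrigin := fun i => (hf i).fixesOrigin (hF i).2.1
    have hT : ∀ i, HasTaylorExpansion (fun z => A⁻¹.mulVec (F i (A.mulVec z)))
        ((linMap A⁻¹).comp ((f i).comp (linMap A))) := fun i =>
      (hasTaylorExpansion_linMap A⁻¹).comp ((hf i).comp (hasTaylorExpansion_linMap A) hA0)
        (comp_fixesOrigin (hf0 i) hA0)
    have hlin : ∀ i, ((linMap A⁻¹).comp ((f i).comp (linMap A))).linearPart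
        = Matrix.diagonal (μ i) := fun i => by
      rw [linearPart_comp (comp_fixesOrigin (hf0 i) hA0), linearPart_comp hA0,
        linearPart_linMap, linearPart_linMap, hLA, ← mul_assoc, hBA, one_mul]
    obtain ⟨Φ, M, h, hΦ, hM⟩ := exists_convergent_normalizedIntegration
      (fun i => (isGermOfBiholomorphism_mulVec hBA).comp
        ((hF i).comp (isGermOfBiholomorphism_mulVec hAB)))
      hT (FormallyCompletelyIntegrable.conj hAB hf0 hint) hlin hμ
    exact ⟨_, _, (h.isHolomorphicIntegration hT hΦ hM).of_conj hAB⟩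
  · intro μ hlin
    obtain ⟨Φ, M, h, hΦ, hM⟩ := exists_convergent_normalizedIntegration hF hf hint hlin
      (diagonalPoincareType_of_poincareType hP hlin)
    refine ⟨Φ, ⟨h.normalized, h.transforms⟩,
      fun Ψ hΨ hΨf => eq_of_isNormalized hlin h.normalized h.transforms hΨ hΨf,
      fun z j => evalSeries (Φ j) z, fun i j => evalSeries (M i j), fun j => (hΦ j).hasSeries,
      h.isHolomorphicIntegration hf hΦ hM, fun i j => ?_⟩
    simp only [evalSeries_zero, h.constantCoeff_eq]
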